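/- Let $\delta>0$ and $0<E_{\min}\le E_{\max}$. Let $\alpha,V:\mathbb R\to\mathbb R$ be functions of bounded variation with $\inf_{\mathbb R}\alpha>0$ and $\sup_{\mathbb R}V<E_{\min}$. For $E,h>0$ let $$P(h)=-h\,\partial_x(\alpha(x)\,h\,\partial_x)+V(x)-E,$$ regarded as an unbounded operator on $L^2(\mathbb R)$ with domain $$\mathcal D=\{u\in L^2(\mathbb R): u,u'\in L^2(\mathbb R)\cap L^\infty(\mathbb R)\ \text{and}\ P(h)u\in L^2(\mathbb R)\},$$ where derivatives are taken in the sense of distributions. Then there exist constants $C,h_0>0$ such that for all $E\in[E_{\min},E_{\max}]$, all $h\in(0,h_0]$ and all $\varepsilon>0$, the operator $P(h)-i\varepsilon:\mathcal D\to L^2(\mathbb R)$ has a bounded inverse $(P(h)-i\varepsilon)^{-1}$ on $L^2(\mathbb R)$, and $$\bigl\|(|x|+1)^{-\frac{1+\delta}{2}}\,(P(h)-i\varepsilon)^{-1}\,(|x|+1)^{-\frac{1+\delta}{2}}\bigr\|_{L^2(\mathbb R)\to L^2(\mathbb R)}\le C\,h^{-1}.$$ -/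

import Mathlib

open MeasureTheory Set
open scoped ENNReal ContDiff

/-- The Hilbert space `L²(ℝ)` of complex-valued functions, with respect to Lebesgue measure. -/
abbrev L2R : Type := Lp ℂ 2 (volume : Measure ℝ)

/-- `v` is the derivative of `u` in the sense of distributions on `ℝ`, both being locally
integrable functions: `∫ φ' u = - ∫ φ v` for every test function `φ`. -/
def HasWeakDeriv (u v : ℝ → ℂ) : Prop :=
  LocallyIntegrable u ∧ LocallyIntegrable v ∧
    ∀ φ : ℝ → ℝ, ContDiff ℝ ∞ φ → HasCompactSupport φ →
      ∫ x, deriv φ x • u x = - ∫ x, φ x • v x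

theorem HasWeakDeriv.zero : HasWeakDeriv (fun _ => 0) (fun _ => 0) :=
  ⟨locallyIntegrable_zero, locallyIntegrable_zero, by simp⟩

theorem HasWeakDeriv.add {u₁ v₁ u₂ v₂ : ℝ → ℂ} (h₁ : HasWeakDeriv u₁ v₁)
    (h₂ : HasWeakDeriv u₂ v₂) :
    HasWeakDeriv (fun x => u₁ x + u₂ x) (fun x => v₁ x + v₂ x) := by
  refine ⟨h₁.1.add h₂.1, h₁.2.1.add h₂.2.1, fun φ hφ hc => ?_⟩
  have hd : Continuous (deriv φ) := hφ.continuous_deriv (by simp)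
  simp only [smul_add]
  rw [integral_add (h₁.1.integrable_smul_left_of_hasCompactSupport hd hc.deriv)
      (h₂.1.integrable_smul_left_of_hasCompactSupport hd hc.deriv),
    integral_add (h₁.2.1.integrable_smul_left_of_hasCompactSupport hφ.continuous hc)
      (h₂.2.1.integrable_smul_left_of_hasCompactSupport hφ.continuous hc),
    h₁.2.2 φ hφ hc, h₂.2.2 φ hφ hc]
  ring

theorem HasWeakDeriv.const_mul (c : ℂ) {u v : ℝ → ℂ} (h : HasWeakDeriv u v) :
    HasWeakDeriv (fun x => c * u x) (fun x => c * v x) := by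
  refine ⟨h.1.smul c, h.2.1.smul c, fun φ hφ hc => ?_⟩
  simp only [← smul_eq_mul, smul_comm _ c, integral_smul]
  rw [h.2.2 φ hφ hc, smul_neg]

theorem HasWeakDeriv.congr {u v u' : ℝ → ℂ} (h : HasWeakDeriv u v) (hu : u =ᵐ[volume] u') :
    HasWeakDeriv u' v := by
  refine ⟨h.1.congr hu, h.2.1, fun φ hφ hc => ?_⟩
  rw [← h.2.2 φ hφ hc]
  exact integral_congr_ae (hu.mono fun x hx => by simp only [hx])

theorem HasWeakDeriv.eq_zero {u v : ℝ → ℂ} (h : HasWeakDeriv u v) (hu : u =ᵐ[volume] fun _ => 0) :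
    v =ᵐ[volume] fun _ => 0 := by
  refine ae_eq_zero_of_integral_contDiff_smul_eq_zero h.2.1 fun φ hφ hc => ?_
  have := (h.congr hu).2.2 φ hφ hc
  simpa using this.symm

/-- The graph of the operator `P(h) = - h ∂ₓ (α h ∂ₓ) + V - E` on `L²(ℝ)` with domain
`{u ∈ L² : u, u' ∈ L² ∩ L^∞, P u ∈ L²}`: the pairs `(u, g)` in `L² × L²` with `g = P u`,
derivatives being taken in the sense of distributions
(here `u₁ = u'` and `u₂ = (α h u')'`). -/
def schrodingerGraph (α V : ℝ → ℝ) (E h : ℝ) : Submodule ℂ (L2R × L2R) where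
  carrier := {p | MemLp p.1 ∞ volume ∧
    ∃ u₁ u₂ : ℝ → ℂ, HasWeakDeriv p.1 u₁ ∧ MemLp u₁ 2 volume ∧ MemLp u₁ ∞ volume ∧
      HasWeakDeriv (fun x => (α x : ℂ) * (h * u₁ x)) u₂ ∧
      p.2 =ᵐ[volume] fun x => -(h : ℂ) * u₂ x + ((V x : ℂ) - E) * p.1 x}
  zero_mem' := by
    have h0 : ((0 : L2R) : ℝ → ℂ) =ᵐ[volume] fun _ => 0 := Lp.coeFn_zero ℂ 2 volume
    refine ⟨MemLp.zero.ae_eq h0.symm, fun _ => 0, fun _ => 0,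
      HasWeakDeriv.zero.congr h0.symm, MemLp.zero, MemLp.zero, ?_, ?_⟩
    · simpa using HasWeakDeriv.zero
    · exact Filter.Eventually.of_forall fun x => by simp
  add_mem' := by
    rintro ⟨u, f⟩ ⟨w, g⟩ ⟨hu, u₁, u₂, hu1, hu2, hui, hu3, hf⟩ ⟨hw, w₁, w₂, hw1, hw2, hwi, hw3, hg⟩
    refine ⟨(hu.add hw).ae_eq (Lp.coeFn_add u w).symm, fun x => u₁ x + w₁ x,
      fun x => u₂ x + w₂ x, (hu1.add hw1).congr (Lp.coeFn_add u w).symm, hu2.add hw2,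
      hui.add hwi, ?_, ?_⟩
    · simpa only [mul_add] using hu3.add hw3
    · dsimp only at hf hg ⊢
      filter_upwards [hf, hg, Lp.coeFn_add u w, Lp.coeFn_add f g] with x h1 h2 h3 h4
      simp only [Prod.mk_add_mk, h3, h4, Pi.add_apply, h1, h2]
      ring
  smul_mem' := by
    rintro c ⟨u, f⟩ ⟨hu, u₁, u₂, hu1, hu2, hui, hu3, hf⟩
    refine ⟨(hu.const_smul c).ae_eq (Lp.coeFn_smul c u).symm, fun x => c * u₁ x,
      fun x => c * u₂ x, (hu1.const_mul c).congr (Lp.coeFn_smul c u).symm, hu2.const_smul c,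
      hui.const_smul c, ?_, ?_⟩
    · have e : (fun x => (α x : ℂ) * (h * (c * u₁ x))) =
          fun x => c * ((α x : ℂ) * (h * u₁ x)) := by
        funext x
        ring
      rw [e]
      exact hu3.const_mul c
    · dsimp only at hf ⊢
      filter_upwards [hf, Lp.coeFn_smul c u, Lp.coeFn_smul c f] with x h1 h2 h3
      simp only [Prod.smul_mk, h2, h3, Pi.smul_apply, h1, smul_eq_mul]
      ring

theorem schrodingerGraph_single_valued (α V : ℝ → ℝ) (E h : ℝ) (p : L2R × L2R)
    (hp : p ∈ schrodingerGraph α V E h) (h0 : p.1 = 0) : p.2 = 0 := by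
  obtain ⟨-, u₁, u₂, h1, -, -, h2, hf⟩ := hp
  have e0 : (p.1 : ℝ → ℂ) =ᵐ[volume] fun _ => 0 := by
    rw [h0]
    exact Lp.coeFn_zero ℂ 2 volume
  have e1 := h1.eq_zero e0
  have e2 := h2.eq_zero (e1.mono fun x hx => by simp [hx])
  refine Lp.ext (hf.trans (Filter.EventuallyEq.trans ?_ (Lp.coeFn_zero ℂ 2 volume).symm))
  filter_upwards [e0, e2] with x hx hx2
  simp [hx, hx2]

/-- The semiclassical Schrödinger operator `P(h) = - h ∂ₓ (α h ∂ₓ) + V - E` as an unbounded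
operator on `L²(ℝ)`, with domain `{u ∈ L² : u, u' ∈ L² ∩ L^∞, P u ∈ L²}`. -/
noncomputable def schrodingerOp (α V : ℝ → ℝ) (E h : ℝ) : L2R →ₗ.[ℂ] L2R :=
  (schrodingerGraph α V E h).toLinearPMap

theorem schrodingerOp_graph (α V : ℝ → ℝ) (E h : ℝ) :
    (schrodingerOp α V E h).graph = schrodingerGraph α V E h :=
  Submodule.toLinearPMap_graph_eq _ (schrodingerGraph_single_valued α V E h)

/-- The bounded operator `R` is the resolvent `(A - z)⁻¹` of the unbounded operator `A`, i.e.
a two-sided inverse of `A - z : D(A) → H`. -/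
def IsResolventAt {H : Type*} [NormedAddCommGroup H] [NormedSpace ℂ H]
    (A : H →ₗ.[ℂ] H) (z : ℂ) (R : H →L[ℂ] H) : Prop :=
  (∀ f : H, ∃ hf : R f ∈ A.domain, A ⟨R f, hf⟩ - z • R f = f) ∧
    ∀ u : A.domain, R (A u - z • (u : H)) = u

theorem memLp_weight (s : ℝ) (hs : 0 ≤ s) :
    MemLp (fun x : ℝ => (((|x| + 1) ^ (-s) : ℝ) : ℂ)) ∞ volume := by
  have hm : Measurable fun x : ℝ => (((|x| + 1) ^ (-s) : ℝ) : ℂ) := by fun_prop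
  refine memLp_top_of_bound hm.aestronglyMeasurable 1 (Filter.Eventually.of_forall fun x => ?_)
  have hx : (1 : ℝ) ≤ |x| + 1 := by linarith [abs_nonneg x]
  rw [Complex.norm_real, Real.norm_of_nonneg (by positivity)]
  exact Real.rpow_le_one_of_one_le_of_nonpos hx (by linarith)

/-- Multiplication by `(|x| + 1) ^ (-s)`, `s ≥ 0`, as a bounded operator on `L²(ℝ)`. -/
noncomputable def weightOp (s : ℝ) (hs : 0 ≤ s) : L2R →L[ℂ] L2R :=
  (ContinuousLinearMap.mul ℂ ℂ).holderL volume ∞ 2 2 ((memLp_weight s hs).toLp _)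

theorem weightOp_apply (s : ℝ) (hs : 0 ≤ s) (f : L2R) :
    weightOp s hs f =ᵐ[volume] fun x => (((|x| + 1) ^ (-s) : ℝ) : ℂ) * f x := by
  have h1 := (ContinuousLinearMap.mul ℂ ℂ).coeFn_holder (r := 2)
    ((memLp_weight s hs).toLp _) f
  filter_upwards [h1, (memLp_weight s hs).coeFn_toLp] with x h2 h3
  rw [h3] at h2
  exact h2

/-! Put `A = 1/α` and `B = E - V`. With `U = u` and `W = α h u'`, the equation `(P(h) - iε) u = g`
becomes the first order system `h U' = A W`, `h W' = -(B + iε) U - g`. Both `A` and `B` lie between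
positive constants and have bounded variation, uniformly in `E`.

The energy `A|W|² + B|U|²` is conserved for constant coefficients and `g = ε = 0`, because the two
cross terms in `Re (U conj W)` cancel. In general it grows only through the variation of `A` and `B`
and through the source `(ε|U| + |g|)|W| / h`. A Gronwall argument with respect to the total
variation (`SystemSolution.energy_le`) costs a constant factor independent of `h`. Since `U` and `W`
are square integrable, the energy vanishes at `-∞`, so it is bounded everywhere by the integral of
the source.

The imaginary and real parts of the identity obtained by integrating `(W conj U)'` bound `ε∫|U|²`
and, for `ε ≤ 1`, `ε∫|W|²` by a multiple of `∫|g||U|`. Hence the supremum of the energy is at most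
`C h⁻¹ ‖g‖₁` times its own square root, which gives the `L¹ → L^∞` bound `C h⁻¹` of
`SystemSolution.norm_le`. The weight is in `L²`, so Cauchy–Schwarz on the input and boundedness on
the output turn this into the weighted estimate. For `ε > 1` the bound `‖u‖ ≤ ‖g‖ / ε` suffices.

The resolvent itself comes from Lax–Milgram on `H¹(ℝ)` (`exists_variational_solution`); the bound
`ε‖u‖ ≤ ‖g‖` gives uniqueness. -/

/-! ### Primitives of locally integrable functions -/

/-- `U` is a primitive of the locally integrable function `U'`. -/
def IsPrimitive {F : Type*} [NormedAddCommGroup F] [NormedSpace ℝ F] (U U' : ℝ → F) : Prop :=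
  LocallyIntegrable U' ∧ ∀ x y, ∫ t in x..y, U' t = U y - U x

namespace IsPrimitive

open Filter Topology ComplexConjugate

section General

variable {F : Type*} [NormedAddCommGroup F] [NormedSpace ℝ F] {U U' : ℝ → F}

theorem intervalIntegrable (h : IsPrimitive U U') (a b : ℝ) : IntervalIntegrable U' volume a b :=
  intervalIntegrable_iff.mpr <|
    (h.1.integrableOn_isCompact isCompact_uIcc).mono_set uIoc_subset_uIcc

theorem eq_add (h : IsPrimitive U U') (x : ℝ) : U x = U 0 + ∫ t in (0 : ℝ)..x, U' t := by
  rw [h.2]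
  abel

theorem of_integral (c : F) (h : LocallyIntegrable U') :
    IsPrimitive (fun x => c + ∫ t in (0 : ℝ)..x, U' t) U' := by
  have hi (x y : ℝ) : IntervalIntegrable U' volume x y := intervalIntegrable_iff.mpr <|
    (h.integrableOn_isCompact isCompact_uIcc).mono_set uIoc_subset_uIcc
  refine ⟨h, fun x y => ?_⟩
  dsimp only
  rw [← intervalIntegral.integral_interval_sub_left (hi 0 y) (hi 0 x)]
  abel

theorem congr_deriv {V : ℝ → F} (h : IsPrimitive U U') (hV : U' =ᵐ[volume] V) :
    IsPrimitive U V := by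
  refine ⟨h.1.congr hV, fun x y => ?_⟩
  rw [← h.2 x y]
  exact intervalIntegral.integral_congr_ae (hV.mono fun t ht _ => ht.symm)

theorem continuous (h : IsPrimitive U U') : Continuous U := by
  have : U = fun x => U 0 + ∫ t in (0 : ℝ)..x, U' t := funext h.eq_add
  rw [this]
  exact continuous_const.add (intervalIntegral.continuous_primitive h.intervalIntegrable 0)

/-- The increments of `U` are dominated by those of the scalar primitive of `‖U'‖`, which is
absolutely continuous. -/
theorem absolutelyContinuousOnInterval (h : IsPrimitive U U') (a b : ℝ) :
    AbsolutelyContinuousOnInterval U a b := by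
  have hn := (h.intervalIntegrable a b).norm.absolutelyContinuousOnInterval_intervalIntegral
    (c := a) (by simp)
  refine squeeze_zero (fun E => Finset.sum_nonneg fun _ _ => dist_nonneg) (fun E => ?_) hn
  refine Finset.sum_le_sum fun i _ => ?_
  have hi : ∀ x y, IntervalIntegrable (fun t => ‖U' t‖) volume x y :=
    fun x y => (h.intervalIntegrable x y).norm
  rw [dist_comm, dist_eq_norm, ← h.2, dist_comm, Real.dist_eq,
    intervalIntegral.integral_interval_sub_left (hi _ _) (hi _ _)]
  exact intervalIntegral.norm_integral_le_abs_integral_norm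

theorem ae_hasDerivAt [CompleteSpace F] (h : IsPrimitive U U') :
    ∀ᵐ x, HasDerivAt U (U' x) x := by
  filter_upwards [LocallyIntegrable.ae_hasDerivAt_integral h.1] with x hx
  have : U = fun x => U 0 + ∫ t in (0 : ℝ)..x, U' t := funext h.eq_add
  rw [this]
  exact (hx 0).const_add _

/-- The difference between `U` and the integral of `U'` is absolutely continuous with derivative
zero almost everywhere, hence constant. Product rules reduce to this criterion. -/
theorem of_ae_hasDerivAt [CompleteSpace F] (hac : ∀ a b, AbsolutelyContinuousOnInterval U a b)
    (hint : LocallyIntegrable U') (hd : ∀ᵐ x, HasDerivAt U (U' x) x) : IsPrimitive U U' := by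
  refine ⟨hint, fun x y => ?_⟩
  have hp := of_integral 0 hint
  obtain ⟨C, hC⟩ := ((hac x y).sub
    (hp.absolutelyContinuousOnInterval x y)).const_of_ae_hasDerivAt_zero (by
      filter_upwards [hd, hp.ae_hasDerivAt] with t h1 h2 _
      simpa using h1.sub h2)
  have h1 := (hC x left_mem_uIcc).trans (hC y right_mem_uIcc).symm
  simp only [Pi.sub_apply] at h1
  rw [hp.2, eq_comm, sub_eq_sub_iff_sub_eq_sub, h1]

theorem smul {𝕜 : Type*} [RCLike 𝕜] [NormedSpace 𝕜 F] [IsScalarTower ℝ 𝕜 F] [CompleteSpace F]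
    {f f' : ℝ → 𝕜} (hf : IsPrimitive f f') (h : IsPrimitive U U') :
    IsPrimitive (fun x => f x • U x) (fun x => f x • U' x + f' x • U x) := by
  refine of_ae_hasDerivAt (fun a b => (hf.absolutelyContinuousOnInterval a b).fun_smul
    (h.absolutelyContinuousOnInterval a b)) ?_ ?_
  · exact (h.1.continuous_smul hf.continuous).add (hf.1.smul_continuous h.continuous)
  · filter_upwards [hf.ae_hasDerivAt, h.ae_hasDerivAt] with x h1 h2
    exact h1.smul h2

theorem clm_apply {G : Type*} [NormedAddCommGroup G] [NormedSpace ℝ G] [CompleteSpace F]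
    [CompleteSpace G] (L : F →L[ℝ] G)
    (h : IsPrimitive U U') : IsPrimitive (fun x => L (U x)) (fun x => L (U' x)) := by
  refine ⟨fun x => ?_, fun x y => ?_⟩
  · obtain ⟨s, hs, hi⟩ := h.1 x
    exact ⟨s, hs, L.integrable_comp hi⟩
  · rw [L.intervalIntegral_comp_comm (h.intervalIntegrable x y), h.2, map_sub]

theorem of_contDiff {f : ℝ → ℝ} (hf : ContDiff ℝ ∞ f) : IsPrimitive f (deriv f) := by
  have hc : Continuous (deriv f) := hf.continuous_deriv (by simp)
  refine ⟨hc.locallyIntegrable, fun x y => ?_⟩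
  exact intervalIntegral.integral_deriv_eq_sub
    (fun t _ => (hf.differentiable (by simp)).differentiableAt) (hc.intervalIntegrable x y)

/-- Integrability of `U'` makes the limit exist; integrability of `U` on half-lines of infinite
measure forces it to vanish. -/
theorem tendsto_atTop (h : IsPrimitive U U') (hU : Integrable U) (hU' : Integrable U') :
    Tendsto U atTop (𝓝 0) := by
  have h1 : Tendsto U atTop (𝓝 (U 0 + ∫ t in Ioi (0 : ℝ), U' t)) := by
    have := intervalIntegral_tendsto_integral_Ioi 0 hU'.integrableOn tendsto_id
    refine (this.const_add (U 0)).congr fun x => ?_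
    exact (h.eq_add x).symm
  have hi : IntegrableAtFilter U atTop := ⟨univ, univ_mem, hU.integrableOn⟩
  rwa [IntegrableAtFilter.eq_zero_of_tendsto hi (fun s hs => ?_) h1] at h1
  rcases mem_atTop_sets.1 hs with ⟨b, hb⟩
  rw [← top_le_iff, ← Real.volume_Ici (a := b)]
  exact measure_mono hb

theorem tendsto_atBot (h : IsPrimitive U U') (hU : Integrable U) (hU' : Integrable U') :
    Tendsto U atBot (𝓝 0) := by
  have h1 : Tendsto U atBot (𝓝 (U 0 - ∫ t in Iic (0 : ℝ), U' t)) := by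
    have := intervalIntegral_tendsto_integral_Iic 0 hU'.integrableOn tendsto_id
    refine (this.const_sub (U 0)).congr fun x => ?_
    rw [h.2, id, sub_sub_cancel]
  have hi : IntegrableAtFilter U atBot := ⟨univ, univ_mem, hU.integrableOn⟩
  rwa [IntegrableAtFilter.eq_zero_of_tendsto hi (fun s hs => ?_) h1] at h1
  rcases mem_atBot_sets.1 hs with ⟨b, hb⟩
  rw [← top_le_iff, ← Real.volume_Iic (a := b)]
  exact measure_mono hb

theorem integral_eq_zero (h : IsPrimitive U U') (hU : Integrable U) (hU' : Integrable U') :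
    ∫ x, U' x = 0 := by
  have h1 := intervalIntegral_tendsto_integral hU' tendsto_neg_atTop_atBot tendsto_id
  have h2 := (h.tendsto_atTop hU hU').sub
    ((h.tendsto_atBot hU hU').comp tendsto_neg_atTop_atBot)
  rw [sub_zero] at h2
  refine tendsto_nhds_unique h1 (h2.congr fun x => ?_)
  rw [h.2]
  rfl

end General

section Complex

variable {U U' W W' : ℝ → ℂ}

theorem hasWeakDeriv (h : IsPrimitive U U') : HasWeakDeriv U U' := by
  refine ⟨h.continuous.locallyIntegrable, h.1, fun φ hφ hc => ?_⟩
  have hd : Continuous (deriv φ) := hφ.continuous_deriv (by simp)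
  have i1 := h.1.integrable_smul_left_of_hasCompactSupport hφ.continuous hc
  have hL := h.continuous.locallyIntegrable (μ := volume)
  have i2 := hL.integrable_smul_left_of_hasCompactSupport hd hc.deriv
  have := ((of_contDiff hφ).smul h).integral_eq_zero
    (hL.integrable_smul_left_of_hasCompactSupport hφ.continuous hc) (i1.add i2)
  rw [integral_add i1 i2] at this
  rw [eq_neg_iff_add_eq_zero, add_comm, this]

/-- The product rule for `U * conj W`. -/
theorem mul_conj (h : IsPrimitive U U') (h' : IsPrimitive W W') :
    IsPrimitive (fun x => U x * conj (W x))
      (fun x => U x * conj (W' x) + U' x * conj (W x)) :=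
  h.smul (h'.clm_apply (Complex.conjCLE : ℂ →L[ℝ] ℂ))

theorem normSq (h : IsPrimitive U U') :
    IsPrimitive (fun x => ‖U x‖ ^ 2) (fun x => 2 * (U' x * conj (U x)).re) := by
  convert (h.mul_conj h).clm_apply Complex.reCLM using 2 with x x
  · rw [Complex.mul_conj, Complex.normSq_eq_norm_sq]
    rfl
  · simp only [Complex.reCLM_apply, Complex.add_re, Complex.mul_re, Complex.conj_re,
      Complex.conj_im]
    ring

end Complex

end IsPrimitive

/-! ### Weak derivatives and primitives -/

/-- A smooth compactly supported function with integral zero is the derivative of such a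
function. -/
theorem exists_contDiff_deriv_eq {f : ℝ → ℝ} (hf : ContDiff ℝ ∞ f) (hc : HasCompactSupport f)
    (h0 : ∫ x, f x = 0) : ∃ g : ℝ → ℝ, ContDiff ℝ ∞ g ∧ HasCompactSupport g ∧ deriv g = f := by
  obtain ⟨r, hr⟩ := hc.isCompact.isBounded.subset_closedBall 0
  rw [Real.closedBall_eq_Icc, zero_sub, zero_add] at hr
  have hz : ∀ x, x ∉ Icc (-r) r → f x = 0 := fun x hx =>
    image_eq_zero_of_notMem_tsupport fun h => hx (hr h)
  -- The base point `-r - 1` lies strictly to the left of the support, so that the support is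
  -- contained in the half-open interval `Ioc (-r - 1) x` once `x > r + 1`.
  have hd : ∀ x, HasDerivAt (fun x => ∫ t in (-r - 1)..x, f t) (f x) x := fun x =>
    intervalIntegral.integral_hasDerivAt_right (hf.continuous.intervalIntegrable _ _)
      (hf.continuous.stronglyMeasurableAtFilter _ _) hf.continuous.continuousAt
  have hd' := deriv_eq hd
  refine ⟨fun x => ∫ t in (-r - 1)..x, f t, ?_, ?_, hd'⟩
  · rw [contDiff_infty_iff_deriv, hd']
    exact ⟨fun x => (hd x).differentiableAt, hf⟩
  · refine HasCompactSupport.intro (isCompact_Icc (a := -r - 1) (b := r + 1)) fun x hx => ?_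
    rw [mem_Icc, not_and_or, not_le, not_le] at hx
    rcases hx with hx | hx
    · refine (intervalIntegral.integral_congr fun t ht => ?_).trans
        (intervalIntegral.integral_zero (a := -r - 1) (b := x) (μ := volume))
      rw [uIcc_of_ge hx.le] at ht
      exact hz t fun h => by linarith [h.1, ht.2]
    · rw [intervalIntegral.integral_eq_integral_of_support_subset, h0]
      intro t ht
      by_contra hn
      refine ht (hz t fun h => hn ⟨?_, ?_⟩) <;> linarith [h.1, h.2]

/-- Du Bois-Reymond's argument: subtracting from `φ` the multiple `∫ φ` of a fixed bump of mass one
leaves the derivative of a test function, against which `u` integrates to zero. -/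
theorem HasWeakDeriv.exists_ae_eq_const {u : ℝ → ℂ} (h : HasWeakDeriv u fun _ => 0) :
    ∃ c : ℂ, u =ᵐ[volume] fun _ => c := by
  let b : ContDiffBump (0 : ℝ) := ⟨1, 2, one_pos, one_lt_two⟩
  have hb : ContDiff ℝ ∞ (b.normed volume) := b.contDiff_normed
  have hbc := b.hasCompactSupport_normed (μ := volume)
  have hb1 := b.integral_normed (μ := volume)
  refine ⟨∫ x, b.normed volume x • u x, ?_⟩
  refine ae_eq_of_integral_contDiff_smul_eq h.1 (locallyIntegrable_const _) fun φ hφ hφc => ?_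
  have hφi := hφ.continuous.integrable_of_hasCompactSupport hφc (μ := volume)
  have hbi := hb.continuous.integrable_of_hasCompactSupport hbc (μ := volume)
  have i1 := h.1.integrable_smul_left_of_hasCompactSupport hφ.continuous hφc
  have i2 := h.1.integrable_smul_left_of_hasCompactSupport hb.continuous hbc
  obtain ⟨g, hg, hgc, hgd⟩ := exists_contDiff_deriv_eq
    (f := fun x => φ x - (∫ t, φ t) * b.normed volume x) (hφ.sub (contDiff_const.mul hb))
    (hφc.sub hbc.mul_left)
    (by rw [integral_sub hφi (hbi.const_mul _), integral_const_mul, hb1]; ring)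
  have := h.2.2 g hg hgc
  simp only [hgd, sub_smul, mul_smul, smul_zero, integral_zero, neg_zero] at this
  rw [integral_sub i1 (by exact i2.smul (∫ t, φ t)), integral_smul, sub_eq_zero] at this
  rw [this, integral_smul_const]

theorem HasWeakDeriv.exists_isPrimitive {u v : ℝ → ℂ} (h : HasWeakDeriv u v) :
    ∃ U, u =ᵐ[volume] U ∧ IsPrimitive U v := by
  have hp := IsPrimitive.of_integral 0 h.2.1
  have h1 := h.add (hp.hasWeakDeriv.const_mul (-1))
  simp only [neg_mul, one_mul, add_neg_cancel] at h1
  obtain ⟨c, hc⟩ := h1.exists_ae_eq_const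
  refine ⟨_, ?_, IsPrimitive.of_integral c h.2.1⟩
  filter_upwards [hc] with x hx
  rw [← hx]
  ring

/-! ### The energy estimate on a bounded interval -/

/-- A function whose increments over short intervals are negligible compared to those of another
function does not increase. -/
theorem le_of_forall_exists_sub_le {f μ : ℝ → ℝ} {a b : ℝ} (hab : a ≤ b)
    (h : ∀ η > 0, ∃ δ > 0, ∀ x y, a ≤ x → x ≤ y → y ≤ b → y - x < δ →
      f y - f x ≤ η * (μ y - μ x)) : f b ≤ f a := by
  have key : ∀ η > 0, f b - f a ≤ η * (μ b - μ a) := by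
    intro η hη
    obtain ⟨δ, hδ, hd⟩ := h η hη
    obtain ⟨N, hN⟩ := exists_nat_gt ((b - a) / δ)
    have hN0 : (0 : ℝ) < N := (div_nonneg (sub_nonneg.2 hab) hδ.le).trans_lt hN
    have hs : (b - a) / N < δ := by
      rw [div_lt_iff₀ hδ] at hN
      rw [div_lt_iff₀ hN0]
      linarith
    have hs0 : 0 ≤ (b - a) / N := div_nonneg (sub_nonneg.2 hab) hN0.le
    -- The increments of `f` and `μ` telescope along a uniform partition of mesh less than `δ`; no
    -- continuity of `μ` is needed.
    have ind : ∀ k : ℕ, k ≤ N →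
        f (a + k * ((b - a) / N)) - f a ≤ η * (μ (a + k * ((b - a) / N)) - μ a) := by
      intro k
      induction k with
      | zero => simp
      | succ k ih =>
        intro hk
        have h1 := ih (by lia)
        have hk' : (k : ℝ) + 1 ≤ N := by exact_mod_cast hk
        have h2 := hd (a + k * ((b - a) / N)) (a + ((k + 1 : ℕ) : ℝ) * ((b - a) / N))
          (by nlinarith [mul_nonneg (Nat.cast_nonneg (α := ℝ) k) hs0])
          (by push_cast; linarith) (by
            have h3 : N * ((b - a) / N) = b - a := by field_simp
            have h4 := mul_le_mul_of_nonneg_right hk' hs0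
            push_cast
            linarith) (by push_cast; linarith)
        linarith
    have h5 := ind N le_rfl
    have h6 : a + N * ((b - a) / N) = b := by field_simp; ring
    rwa [h6] at h5
  have hlim : Filter.Tendsto (fun η : ℝ => η * (μ b - μ a)) (nhdsWithin 0 (Ioi 0)) (nhds 0) := by
    have : Filter.Tendsto (fun η : ℝ => η * (μ b - μ a)) (nhds 0) (nhds (0 * (μ b - μ a))) :=
      (continuous_id.mul continuous_const).tendsto 0
    rw [zero_mul] at this
    exact this.mono_left nhdsWithin_le_nhds
  have := ge_of_tendsto hlim (eventually_nhdsWithin_of_forall key)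
  linarith

/-- Coefficients between two positive constants, whose variation is dominated by a monotone
function `m`. -/
structure EnergyCoeffs (A B m : ℝ → ℝ) (κ K : ℝ) : Prop where
  pos : 0 < κ
  left_ge : ∀ x, κ ≤ A x
  left_le : ∀ x, A x ≤ K
  right_ge : ∀ x, κ ≤ B x
  right_le : ∀ x, B x ≤ K
  left_meas : Measurable A
  right_meas : Measurable B
  mono : Monotone m
  left_sub_le : ∀ ⦃x y⦄, x ≤ y → |A y - A x| ≤ m y - m x
  right_sub_le : ∀ ⦃x y⦄, x ≤ y → |B y - B x| ≤ m y - m x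

/-- `(U, W)` solves the first order system `h U' = A W`, `h W' = -(B + i ε) U - G`. -/
structure SystemSolution (A B : ℝ → ℝ) (h ε : ℝ) (G U W : ℝ → ℂ) : Prop where
  left : IsPrimitive U fun t => (A t : ℂ) * W t / h
  right : IsPrimitive W fun t => -(((B t : ℂ) + Complex.I * ε) * U t + G t) / h

/-- The energy of a solution of the first order system. -/
noncomputable def energy (A B : ℝ → ℝ) (U W : ℝ → ℂ) (x : ℝ) : ℝ := A x * ‖W x‖ ^ 2 + B x * ‖U x‖ ^ 2

/-- The source term in the energy estimate. -/
noncomputable def energySource (K h ε : ℝ) (G U W : ℝ → ℂ) (t : ℝ) : ℝ :=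
  2 * K / h * ((ε * ‖U t‖ + ‖G t‖) * ‖W t‖)

namespace SystemSolution

open Filter Topology ComplexConjugate

variable {A B m : ℝ → ℝ} {κ K h ε : ℝ} {G U W : ℝ → ℂ}

/-- The coefficients in front of `‖W‖²` and `‖U‖²` are frozen at `x`, since `A` and `B` need not be
differentiable. The cross terms then cancel only up to `B x * A t - A x * B t`, which is controlled
by the increment of `m`. -/
theorem deriv_energy_le (hc : EnergyCoeffs A B m κ K) (hh : 0 < h) (hε : 0 < ε) {x t : ℝ}
    (hxt : x ≤ t) :
    A x * (2 * ((-(((B t : ℂ) + Complex.I * ε) * U t + G t) / h) * conj (W t)).re) +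
      B x * (2 * (((A t : ℂ) * W t / h) * conj (U t)).re) ≤
    4 * K / h * (m t - m x) * (‖U t‖ * ‖W t‖) + energySource K h ε G U W t := by
  set z := U t * conj (W t) with hz
  have hzn : ‖z‖ = ‖U t‖ * ‖W t‖ := by rw [hz, norm_mul, RCLike.norm_conj]
  have e1 : ((-(((B t : ℂ) + Complex.I * ε) * U t + G t) / h) * conj (W t)).re =
      h⁻¹ * (-B t * z.re + ε * z.im - (G t * conj (W t)).re) := by
    have : (-(((B t : ℂ) + Complex.I * ε) * U t + G t) / h) * conj (W t) =
      ((h⁻¹ : ℝ) : ℂ) * (((-B t : ℝ) : ℂ) * z - ((ε : ℝ) : ℂ) * (Complex.I * z)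
        - G t * conj (W t)) := by
      rw [hz]; push_cast; ring
    rw [this, Complex.re_ofReal_mul, Complex.sub_re, Complex.sub_re, Complex.re_ofReal_mul,
      Complex.re_ofReal_mul, Complex.I_mul_re]
    ring
  have e2 : (((A t : ℂ) * W t / h) * conj (U t)).re = h⁻¹ * (A t * z.re) := by
    have : ((A t : ℂ) * W t / h) * conj (U t) = ((h⁻¹ : ℝ) : ℂ) * ((A t : ℂ) * conj z) := by
      rw [hz, map_mul, Complex.conj_conj]; push_cast; ring
    rw [this, Complex.re_ofReal_mul, Complex.re_ofReal_mul, Complex.conj_re]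
  have hK : 0 < K := hc.pos.trans_le ((hc.left_ge x).trans (hc.left_le x))
  have b1 : |z.re| ≤ ‖U t‖ * ‖W t‖ := hzn ▸ Complex.abs_re_le_norm z
  have b2 : |z.im| ≤ ‖U t‖ * ‖W t‖ := hzn ▸ Complex.abs_im_le_norm z
  have b3 : |(G t * conj (W t)).re| ≤ ‖G t‖ * ‖W t‖ := by
    refine (Complex.abs_re_le_norm _).trans_eq ?_
    rw [norm_mul, RCLike.norm_conj]
  have hA := hc.left_sub_le hxt
  have hB := hc.right_sub_le hxt
  have b4 : |B x * A t - A x * B t| ≤ 2 * K * (m t - m x) := by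
    have : B x * A t - A x * B t = B x * (A t - A x) + A x * -(B t - B x) := by ring
    rw [this]
    refine (abs_add_le _ _).trans ?_
    rw [abs_mul, abs_mul, abs_neg, abs_of_pos (hc.pos.trans_le (hc.right_ge x)),
      abs_of_pos (hc.pos.trans_le (hc.left_ge x))]
    have h1 := mul_le_mul (hc.right_le x) hA (abs_nonneg _) hK.le
    have h2 := mul_le_mul (hc.left_le x) hB (abs_nonneg _) hK.le
    linarith
  have b5 : (B x * A t - A x * B t) * z.re ≤ 2 * K * (m t - m x) * (‖U t‖ * ‖W t‖) := by
    refine (le_abs_self _).trans ?_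
    rw [abs_mul]
    exact mul_le_mul b4 b1 (abs_nonneg _)
      (mul_nonneg (by positivity) (sub_nonneg.2 (hc.mono hxt)))
  have b6 : A x * (ε * z.im - (G t * conj (W t)).re) ≤ K * ((ε * ‖U t‖ + ‖G t‖) * ‖W t‖) := by
    have h1 : ε * z.im ≤ ε * (‖U t‖ * ‖W t‖) :=
      mul_le_mul_of_nonneg_left ((le_abs_self _).trans b2) hε.le
    have h2 := (neg_le_abs (G t * conj (W t)).re).trans b3
    exact (mul_le_mul_of_nonneg_left (by linarith : _ ≤ (ε * ‖U t‖ + ‖G t‖) * ‖W t‖)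
      (hc.pos.le.trans (hc.left_ge x))).trans
      (mul_le_mul_of_nonneg_right (hc.left_le x) (by positivity))
  rw [e1, e2, energySource]
  have h7 := mul_le_mul_of_nonneg_left (add_le_add b5 b6) (by positivity : 0 ≤ 2 * h⁻¹)
  calc _ = 2 * h⁻¹ * ((B x * A t - A x * B t) * z.re +
        A x * (ε * z.im - (G t * conj (W t)).re)) := by ring
    _ ≤ _ := h7
    _ = _ := by rw [div_eq_mul_inv, div_eq_mul_inv]; ring

theorem locallyIntegrable_energySource (hs : SystemSolution A B h ε G U W)
    (hG : LocallyIntegrable G) : LocallyIntegrable (energySource K h ε G U W) := by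
  have hU := hs.left.continuous
  have hW := hs.right.continuous
  have h1 : LocallyIntegrable fun t => ‖G t‖ := fun x => by
    obtain ⟨s, hs, hi⟩ := hG x
    exact ⟨s, hs, hi.norm⟩
  have h2 : LocallyIntegrable fun t => ε * ‖U t‖ + ‖G t‖ :=
    (continuous_const.mul hU.norm).locallyIntegrable.add h1
  exact (h2.mul_continuous hW.norm).smul (2 * K / h)

/-- Integrating the frozen estimate gives an error proportional to `(m y - m x) * (y - x)`: on short
intervals it is negligible compared with `m y - m x`. -/
theorem energy_sub_le (hc : EnergyCoeffs A B m κ K) (hs : SystemSolution A B h ε G U W)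
    (hG : LocallyIntegrable G) (hh : 0 < h) (hε : 0 < ε) {x y M : ℝ} (hxy : x ≤ y)
    (hM : ∀ t ∈ Icc x y, ‖U t‖ * ‖W t‖ ≤ M) :
    A x * (‖W y‖ ^ 2 - ‖W x‖ ^ 2) + B x * (‖U y‖ ^ 2 - ‖U x‖ ^ 2) ≤
      4 * K / h * (m y - m x) * M * (y - x) + ∫ t in x..y, energySource K h ε G U W t := by
  have hK : 0 < K := hc.pos.trans_le ((hc.left_ge x).trans (hc.left_le x))
  have i3 := (intervalIntegrable_iff.mpr <|
    ((locallyIntegrable_energySource (K := K) hs hG).integrableOn_isCompact isCompact_uIcc).mono_set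
      (uIoc_subset_uIcc (a := x) (b := y)))
  have i1 := (hs.right.normSq.intervalIntegrable x y).const_mul (A x)
  have i2 := (hs.left.normSq.intervalIntegrable x y).const_mul (B x)
  rw [← hs.right.normSq.2, ← hs.left.normSq.2, ← intervalIntegral.integral_const_mul,
    ← intervalIntegral.integral_const_mul, ← intervalIntegral.integral_add i1 i2]
  have i4 : IntervalIntegrable (fun _ : ℝ => 4 * K / h * (m y - m x) * M) volume x y :=
    intervalIntegrable_const
  calc _ ≤ ∫ t in x..y, (4 * K / h * (m y - m x) * M + energySource K h ε G U W t) := by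
        refine intervalIntegral.integral_mono_on hxy (i1.add i2) (i4.add i3) fun t ht => ?_
        refine (deriv_energy_le hc hh hε ht.1).trans (add_le_add_left ?_ _)
        have h1 : 4 * K / h * (m t - m x) ≤ 4 * K / h * (m y - m x) :=
          mul_le_mul_of_nonneg_left (sub_le_sub_right (hc.mono ht.2) _) (by positivity)
        have h2 : 0 ≤ 4 * K / h * (m y - m x) :=
          mul_nonneg (by positivity) (sub_nonneg.2 (hc.mono hxy))
        exact mul_le_mul h1 (hM t ht) (by positivity) h2
    _ = _ := by
        rw [intervalIntegral.integral_add i4 i3, intervalIntegral.integral_const, smul_eq_mul]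
        ring

/-- Gronwall estimate for the energy, with the increments of `m` in place of the derivatives of the
coefficients. -/
theorem energy_le (hc : EnergyCoeffs A B m κ K) (hs : SystemSolution A B h ε G U W)
    (hG : LocallyIntegrable G) (hh : 0 < h) (hε : 0 < ε) {a b : ℝ} (hab : a ≤ b) :
    energy A B U W b ≤ Real.exp ((m b - m a) / κ) *
      (energy A B U W a + ∫ t in a..b, energySource K h ε G U W t) := by
  have hκ := hc.pos
  have hK : 0 < K := hc.pos.trans_le ((hc.left_ge a).trans (hc.left_le a))
  have hUc := hs.left.continuous
  have hWc := hs.right.continuous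
  have hS (x y : ℝ) : IntervalIntegrable (energySource K h ε G U W) volume x y :=
    intervalIntegrable_iff.mpr <|
    ((locallyIntegrable_energySource (K := K) hs hG).integrableOn_isCompact isCompact_uIcc).mono_set
      uIoc_subset_uIcc
  obtain ⟨M, hM⟩ := (isCompact_Icc (a := a) (b := b)).exists_bound_of_continuousOn
    (hUc.norm.mul hWc.norm).continuousOn
  have hM' : ∀ t ∈ Icc a b, ‖U t‖ * ‖W t‖ ≤ M := fun t ht => (le_abs_self _).trans (hM t ht)
  have hM0 : 0 ≤ M := (norm_nonneg _).trans (hM a (left_mem_Icc.2 hab))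
  have hu1 := Metric.uniformContinuousOn_iff.1 ((isCompact_Icc (a := a)
    (b := b)).uniformContinuousOn_of_continuous (hUc.norm.pow 2).continuousOn)
  have hu2 := Metric.uniformContinuousOn_iff.1 ((isCompact_Icc (a := a)
    (b := b)).uniformContinuousOn_of_continuous (hWc.norm.pow 2).continuousOn)
  -- The exponential factor absorbs the growth of the energy, and the subtracted integral absorbs
  -- the source; what remains on a short interval is at most `η * (m y - m x)`.
  have key := le_of_forall_exists_sub_le (μ := m) (f := fun x =>
    Real.exp (-((m x - m a) / κ)) * energy A B U W x - ∫ t in a..x, energySource K h ε G U W t)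
    hab (by
    intro η hη
    obtain ⟨δ₁, hδ₁, h1⟩ := hu1 (η / 3) (by positivity)
    obtain ⟨δ₂, hδ₂, h2⟩ := hu2 (η / 3) (by positivity)
    -- One third of `η` goes to each of the oscillation of `‖U‖ ^ 2`, the oscillation of `‖W‖ ^ 2`
    -- and the frozen-coefficient error. Using `M + 1` avoids a zero denominator.
    refine ⟨min (min δ₁ δ₂) (η / 3 / (4 * K / h * (M + 1))), by positivity,
      fun x y hax hxy hyb hd => ?_⟩
    rw [lt_min_iff, lt_min_iff] at hd
    have hx : x ∈ Icc a b := ⟨hax, hxy.trans hyb⟩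
    have hy : y ∈ Icc a b := ⟨hax.trans hxy, hyb⟩
    have hdist : dist y x = y - x := by rw [Real.dist_eq, abs_of_nonneg (sub_nonneg.2 hxy)]
    have g1 : ‖U y‖ ^ 2 - ‖U x‖ ^ 2 ≤ η / 3 := (le_abs_self _).trans (h1 y hy x hx (hdist ▸ hd.1.1)).le
    have g2 : ‖W y‖ ^ 2 - ‖W x‖ ^ 2 ≤ η / 3 := (le_abs_self _).trans (h2 y hy x hx (hdist ▸ hd.1.2)).le
    have g3 : 4 * K / h * M * (y - x) ≤ η / 3 := by
      have := hd.2.le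
      rw [le_div_iff₀ (by positivity)] at this
      have h3 : 0 ≤ 4 * K / h * (y - x) := mul_nonneg (by positivity) (sub_nonneg.2 hxy)
      linarith
    have g4 := energy_sub_le hc hs hG hh hε hxy
      (fun t ht => hM' t ⟨hax.trans ht.1, ht.2.trans hyb⟩)
    have hΔ : 0 ≤ m y - m x := sub_nonneg.2 (hc.mono hxy)
    have g5 : ‖W x‖ ^ 2 + ‖U x‖ ^ 2 ≤ energy A B U W x / κ := by
      rw [le_div_iff₀ hκ, energy]
      linarith [mul_le_mul_of_nonneg_right (hc.left_ge x) (sq_nonneg ‖W x‖),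
        mul_le_mul_of_nonneg_right (hc.right_ge x) (sq_nonneg ‖U x‖)]
    have g6 : (A y - A x) * ‖W y‖ ^ 2 + (B y - B x) * ‖U y‖ ^ 2 ≤
        (m y - m x) * (‖W y‖ ^ 2 + ‖U y‖ ^ 2) := by
      linarith [mul_le_mul_of_nonneg_right ((le_abs_self _).trans (hc.left_sub_le hxy))
        (sq_nonneg ‖W y‖), mul_le_mul_of_nonneg_right
        ((le_abs_self _).trans (hc.right_sub_le hxy)) (sq_nonneg ‖U y‖)]
    have g7 : (m y - m x) * (‖W y‖ ^ 2 + ‖U y‖ ^ 2) ≤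
        (m y - m x) * (energy A B U W x / κ + 2 * η / 3) :=
      mul_le_mul_of_nonneg_left (by linarith) hΔ
    have g8 := mul_le_mul_of_nonneg_left g3 hΔ
    have g9 : energy A B U W y ≤ energy A B U W x * (1 + (m y - m x) / κ) + η * (m y - m x) +
        ∫ t in x..y, energySource K h ε G U W t := by
      -- Discrete product rule: the jumps of `A` and `B` multiply values at `y`, while the
      -- increments of `‖W‖ ^ 2` and `‖U‖ ^ 2` carry coefficients frozen at `x`.
      have e1 : energy A B U W y = energy A B U W x +
        ((A y - A x) * ‖W y‖ ^ 2 + (B y - B x) * ‖U y‖ ^ 2) +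
        (A x * (‖W y‖ ^ 2 - ‖W x‖ ^ 2) + B x * (‖U y‖ ^ 2 - ‖U x‖ ^ 2)) := by
        rw [energy, energy]; ring
      have e2 : energy A B U W x * (1 + (m y - m x) / κ) = energy A B U W x +
        (m y - m x) * (energy A B U W x / κ) := by ring
      linarith
    have hE0 : 0 ≤ energy A B U W x := by
      have := add_nonneg (sq_nonneg ‖W x‖) (sq_nonneg ‖U x‖)
      have := this.trans g5
      rwa [le_div_iff₀ hκ, zero_mul] at this
    have hsrc : 0 ≤ ∫ t in x..y, energySource K h ε G U W t :=
      intervalIntegral.integral_nonneg hxy fun t _ => by unfold energySource; positivity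
    have g10 : energy A B U W y ≤ energy A B U W x * Real.exp ((m y - m x) / κ) +
        (η * (m y - m x) + ∫ t in x..y, energySource K h ε G U W t) := by
      have := mul_le_mul_of_nonneg_left (Real.add_one_le_exp ((m y - m x) / κ)) hE0
      linarith
    have g11 := mul_le_mul_of_nonneg_left g10 (Real.exp_pos (-((m y - m a) / κ))).le
    have g12 : Real.exp (-((m y - m a) / κ)) * (energy A B U W x * Real.exp ((m y - m x) / κ)) =
        Real.exp (-((m x - m a) / κ)) * energy A B U W x := by
      rw [mul_left_comm, ← Real.exp_add, mul_comm]
      congr 2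
      ring
    have g13 : Real.exp (-((m y - m a) / κ)) ≤ 1 := by
      rw [Real.exp_le_one_iff, neg_nonpos]
      exact div_nonneg (sub_nonneg.2 (hc.mono (hax.trans hxy))) hκ.le
    have g14 := mul_le_mul_of_nonneg_right g13 (add_nonneg (mul_nonneg hη.le hΔ) hsrc)
    have g15 := intervalIntegral.integral_add_adjacent_intervals (hS a x) (hS x y)
    rw [mul_add, g12] at g11
    linarith)
  simp only [sub_self, zero_div, neg_zero, Real.exp_zero, one_mul,
    intervalIntegral.integral_same, sub_zero] at key
  have := mul_le_mul_of_nonneg_left (sub_le_iff_le_add.1 key) (Real.exp_pos ((m b - m a) / κ)).le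
  rwa [← mul_assoc, ← Real.exp_add, add_neg_cancel, Real.exp_zero, one_mul] at this

end SystemSolution

/-! ### Integral identities on the line and the `L¹ → L^∞` bound -/

namespace SystemSolution

open Filter Topology ComplexConjugate

variable {A B m : ℝ → ℝ} {κ K h ε : ℝ} {G U W : ℝ → ℂ}

theorem integrable_norm_mul {f g : ℝ → ℂ} (hf : MemLp f 2) (hg : MemLp g 2) :
    Integrable fun x => ‖f x‖ * ‖g x‖ :=
  hf.norm.integrable_mul hg.norm

theorem integrable_mul_conj {f g : ℝ → ℂ} (hf : MemLp f 2) (hg : MemLp g 2) :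
    Integrable fun x => f x * conj (g x) :=
  hf.integrable_mul hg.star

theorem memLp_deriv_left (hc : EnergyCoeffs A B m κ K) (hW : MemLp W 2) :
    MemLp (fun t => (A t : ℂ) * W t / h) 2 := by
  have h1 : MemLp (fun t => (A t : ℂ) * W t) 2 := by
    refine hW.of_le_mul (c := K)
      ((Complex.measurable_ofReal.comp hc.left_meas).aestronglyMeasurable.mul hW.1)
      (Eventually.of_forall fun t => ?_)
    rw [norm_mul, Complex.norm_real, Real.norm_of_nonneg (hc.pos.le.trans (hc.left_ge t))]
    exact mul_le_mul_of_nonneg_right (hc.left_le t) (norm_nonneg _)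
  simpa only [div_eq_mul_inv] using h1.mul_const ((h : ℂ)⁻¹)

theorem memLp_deriv_right (hc : EnergyCoeffs A B m κ K) (hU : MemLp U 2) (hG : MemLp G 2) :
    MemLp (fun t => -(((B t : ℂ) + Complex.I * ε) * U t + G t) / h) 2 := by
  have h1 : MemLp (fun t => (B t : ℂ) * U t) 2 := by
    refine hU.of_le_mul (c := K)
      ((Complex.measurable_ofReal.comp hc.right_meas).aestronglyMeasurable.mul hU.1)
      (Eventually.of_forall fun t => ?_)
    rw [norm_mul, Complex.norm_real, Real.norm_of_nonneg (hc.pos.le.trans (hc.right_ge t))]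
    exact mul_le_mul_of_nonneg_right (hc.right_le t) (norm_nonneg _)
  have h2 := ((h1.add (hU.const_mul (Complex.I * ε))).add hG).neg.mul_const ((h : ℂ)⁻¹)
  refine h2.congr_norm ?_ ?_
  · refine h2.1.congr (Eventually.of_forall fun t => ?_)
    simp only [Pi.neg_apply, Pi.add_apply]
    rw [add_mul, div_eq_mul_inv]
  · refine Eventually.of_forall fun t => ?_
    simp only [Pi.neg_apply, Pi.add_apply]
    rw [add_mul, div_eq_mul_inv]

/-- The integrand is `L` applied to the derivative of `W * conj U`. Taking imaginary and real parts
for `L` yields the two a priori bounds below. -/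
theorem integral_identity (hc : EnergyCoeffs A B m κ K) (hs : SystemSolution A B h ε G U W)
    (hU : MemLp U 2) (hW : MemLp W 2) (hG : MemLp G 2) (L : ℂ →L[ℝ] ℝ) :
    Integrable (fun t => L (W t * conj ((A t : ℂ) * W t / h) +
      -(((B t : ℂ) + Complex.I * ε) * U t + G t) / h * conj (U t))) ∧
    ∫ t, L (W t * conj ((A t : ℂ) * W t / h) +
      -(((B t : ℂ) + Complex.I * ε) * U t + G t) / h * conj (U t)) = 0 := by
  have hi := L.integrable_comp ((integrable_mul_conj hW (memLp_deriv_left (h := h) hc hW)).add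
    (integrable_mul_conj (memLp_deriv_right (h := h) (ε := ε) hc hU hG) hU))
  exact ⟨hi, ((hs.right.mul_conj hs.left).clm_apply L).integral_eq_zero
    (L.integrable_comp (integrable_mul_conj hW hU)) hi⟩

theorem flux_re (A B h ε : ℝ) (u w g : ℂ) (hh : h ≠ 0) :
    h * (w * conj ((A : ℂ) * w / h) + -(((B : ℂ) + Complex.I * ε) * u + g) / h * conj u).re =
      A * ‖w‖ ^ 2 - B * ‖u‖ ^ 2 - (g * conj u).re := by
  rw [← Complex.re_ofReal_mul]
  have hh' : (h : ℂ) ≠ 0 := by exact_mod_cast hh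
  have : (h : ℂ) * (w * conj ((A : ℂ) * w / h) +
      -(((B : ℂ) + Complex.I * ε) * u + g) / h * conj u) =
      A * (w * conj w) - (B + Complex.I * ε) * (u * conj u) - g * conj u := by
    simp only [map_div₀, map_mul, Complex.conj_ofReal]
    field_simp
    ring
  rw [this, Complex.mul_conj, Complex.mul_conj, Complex.normSq_eq_norm_sq,
    Complex.normSq_eq_norm_sq]
  simp [-Complex.ofReal_pow]

theorem flux_im (A B h ε : ℝ) (u w g : ℂ) (hh : h ≠ 0) :
    h * (w * conj ((A : ℂ) * w / h) + -(((B : ℂ) + Complex.I * ε) * u + g) / h * conj u).im =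
      - ε * ‖u‖ ^ 2 - (g * conj u).im := by
  rw [← Complex.im_ofReal_mul]
  have hh' : (h : ℂ) ≠ 0 := by exact_mod_cast hh
  have : (h : ℂ) * (w * conj ((A : ℂ) * w / h) +
      -(((B : ℂ) + Complex.I * ε) * u + g) / h * conj u) =
      A * (w * conj w) - (B + Complex.I * ε) * (u * conj u) - g * conj u := by
    simp only [map_div₀, map_mul, Complex.conj_ofReal]
    field_simp
    ring
  rw [this, Complex.mul_conj, Complex.mul_conj, Complex.normSq_eq_norm_sq,
    Complex.normSq_eq_norm_sq]
  simp [-Complex.ofReal_pow]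

theorem integral_norm_sq_left_le (hc : EnergyCoeffs A B m κ K)
    (hs : SystemSolution A B h ε G U W) (hh : 0 < h)
    (hU : MemLp U 2) (hW : MemLp W 2) (hG : MemLp G 2) :
    ε * ∫ t, ‖U t‖ ^ 2 ≤ ∫ t, ‖G t‖ * ‖U t‖ := by
  obtain ⟨hi, h0⟩ := integral_identity hc hs hU hW hG Complex.imCLM
  simp only [Complex.imCLM_apply] at hi h0
  have h1 : ∫ t, (ε * ‖U t‖ ^ 2 + h * (W t * conj ((A t : ℂ) * W t / h) +
      -(((B t : ℂ) + Complex.I * ε) * U t + G t) / h * conj (U t)).im) ≤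
      ∫ t, ‖G t‖ * ‖U t‖ := by
    refine integral_mono ((hU.integrable_norm_pow two_ne_zero).const_mul ε |>.add
      (hi.const_mul h)) (integrable_norm_mul hG hU) fun t => ?_
    dsimp only
    rw [flux_im _ _ _ _ _ _ _ hh.ne']
    have := (neg_le_abs _).trans (Complex.abs_im_le_norm (G t * conj (U t)))
    rw [norm_mul, RCLike.norm_conj] at this
    linarith
  rwa [integral_add ((hU.integrable_norm_pow two_ne_zero).const_mul ε) (hi.const_mul h),
    integral_const_mul, integral_const_mul, h0, mul_zero, add_zero] at h1

theorem integral_norm_sq_right_le (hc : EnergyCoeffs A B m κ K)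
    (hs : SystemSolution A B h ε G U W) (hh : 0 < h)
    (hU : MemLp U 2) (hW : MemLp W 2) (hG : MemLp G 2) :
    κ * ∫ t, ‖W t‖ ^ 2 ≤ K * (∫ t, ‖U t‖ ^ 2) + ∫ t, ‖G t‖ * ‖U t‖ := by
  obtain ⟨hi, h0⟩ := integral_identity hc hs hU hW hG Complex.reCLM
  simp only [Complex.reCLM_apply] at hi h0
  have hU2 := (hU.integrable_norm_pow two_ne_zero).const_mul K
  have hGU := integrable_norm_mul hG hU
  have h1 : ∫ t, κ * ‖W t‖ ^ 2 ≤
      ∫ t, ((K * ‖U t‖ ^ 2 + ‖G t‖ * ‖U t‖) + h * (W t * conj ((A t : ℂ) * W t / h) +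
      -(((B t : ℂ) + Complex.I * ε) * U t + G t) / h * conj (U t)).re) := by
    refine integral_mono ((hW.integrable_norm_pow two_ne_zero).const_mul κ)
      ((hU2.add hGU).add (hi.const_mul h)) fun t => ?_
    dsimp only
    rw [flux_re _ _ _ _ _ _ _ hh.ne']
    have := (le_abs_self _).trans (Complex.abs_re_le_norm (G t * conj (U t)))
    rw [norm_mul, RCLike.norm_conj] at this
    have h2 := mul_le_mul_of_nonneg_right (hc.left_ge t) (sq_nonneg ‖W t‖)
    have h3 := mul_le_mul_of_nonneg_right (hc.right_le t) (sq_nonneg ‖U t‖)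
    linarith
  rwa [integral_add (by exact hU2.add hGU) (hi.const_mul h), integral_add hU2 hGU,
    integral_const_mul, integral_const_mul, integral_const_mul, h0, mul_zero, add_zero] at h1

theorem tendsto_energy_atBot (hc : EnergyCoeffs A B m κ K)
    (hs : SystemSolution A B h ε G U W) (hU : MemLp U 2) (hW : MemLp W 2) (hG : MemLp G 2) :
    Tendsto (energy A B U W) atBot (𝓝 0) := by
  have h1 := hs.left.normSq.tendsto_atBot (hU.integrable_norm_pow two_ne_zero)
    ((Complex.reCLM.integrable_comp (integrable_mul_conj (memLp_deriv_left hc hW) hU)).const_mul 2)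
  have h2 := hs.right.normSq.tendsto_atBot (hW.integrable_norm_pow two_ne_zero)
    ((Complex.reCLM.integrable_comp
      (integrable_mul_conj (memLp_deriv_right hc hU hG) hW)).const_mul 2)
  have h3 := (h1.add h2).const_mul K
  rw [add_zero, mul_zero] at h3
  refine squeeze_zero (fun x => ?_) (fun x => ?_) h3
  · exact add_nonneg (mul_nonneg (hc.pos.le.trans (hc.left_ge x)) (sq_nonneg _))
      (mul_nonneg (hc.pos.le.trans (hc.right_ge x)) (sq_nonneg _))
  · have h2 := mul_le_mul_of_nonneg_right (hc.left_le x) (sq_nonneg ‖W x‖)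
    have h3 := mul_le_mul_of_nonneg_right (hc.right_le x) (sq_nonneg ‖U x‖)
    rw [energy]
    linarith

theorem integrable_energySource (hU : MemLp U 2) (hW : MemLp W 2) (hG : MemLp G 2) :
    Integrable (energySource K h ε G U W) := by
  have := ((hU.norm.const_mul ε).add hG.norm).integrable_mul hW.norm
  exact this.const_mul (2 * K / h)

/-- The left endpoint of the Gronwall estimate is sent to `-∞`, where the energy vanishes. -/
theorem energy_le_integral (hc : EnergyCoeffs A B m κ K)
    (hs : SystemSolution A B h ε G U W) (hh : 0 < h) (hε : 0 < ε)
    (hU : MemLp U 2) (hW : MemLp W 2) (hG : MemLp G 2) {T : ℝ} (hT : ∀ x y, m y - m x ≤ T)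
    (x : ℝ) : energy A B U W x ≤ Real.exp (T / κ) * ∫ t, energySource K h ε G U W t := by
  have hK : 0 < K := hc.pos.trans_le ((hc.left_ge x).trans (hc.left_le x))
  have hi := integrable_energySource (K := K) (h := h) (ε := ε) hU hW hG
  have hlim := ((tendsto_energy_atBot hc hs hU hW hG).add_const
    (∫ t, energySource K h ε G U W t)).const_mul (Real.exp (T / κ))
  rw [zero_add] at hlim
  have h0 (t : ℝ) : 0 ≤ energySource K h ε G U W t := by unfold energySource; positivity
  refine ge_of_tendsto hlim ((eventually_le_atBot x).mono fun a ha => ?_)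
  refine (energy_le hc hs (hG.locallyIntegrable (by norm_num)) hh hε ha).trans ?_
  have h1 : ∫ t in a..x, energySource K h ε G U W t ≤ ∫ t, energySource K h ε G U W t := by
    rw [intervalIntegral.integral_of_le ha]
    exact setIntegral_le_integral hi (Eventually.of_forall h0)
  have h2 : 0 ≤ ∫ t in a..x, energySource K h ε G U W t :=
    intervalIntegral.integral_nonneg ha fun t _ => h0 t
  have h3 : 0 ≤ energy A B U W a :=
    add_nonneg (mul_nonneg (hc.pos.le.trans (hc.left_ge a)) (sq_nonneg _))
      (mul_nonneg (hc.pos.le.trans (hc.right_ge a)) (sq_nonneg _))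
  have h4 : Real.exp ((m x - m a) / κ) ≤ Real.exp (T / κ) :=
    Real.exp_le_exp.2 (div_le_div_of_nonneg_right (hT a x) hc.pos.le)
  exact mul_le_mul h4 (by linarith) (by linarith) (Real.exp_pos _).le

/-- Splitting `ε‖U‖‖W‖` into squares leaves `ε∫‖U‖²` and `ε∫‖W‖²`, both controlled by `∫‖G‖‖U‖`; the
condition `ε ≤ 1` serves to make the second bound uniform in `ε`. -/
theorem integral_energySource_le (hc : EnergyCoeffs A B m κ K)
    (hs : SystemSolution A B h ε G U W) (hh : 0 < h) (hε : 0 < ε) (hε1 : ε ≤ 1)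
    (hU : MemLp U 2) (hW : MemLp W 2) (hG : MemLp G 2) :
    ∫ t, energySource K h ε G U W t ≤
      2 * K / h * ((1 + (K + 1) / κ) * (∫ t, ‖G t‖ * ‖U t‖) + ∫ t, ‖G t‖ * ‖W t‖) := by
  have hK : 0 < K := hc.pos.trans_le ((hc.left_ge 0).trans (hc.left_le 0))
  have hκ := hc.pos
  have hGW := integrable_norm_mul hG hW
  have hU2 := hU.integrable_norm_pow two_ne_zero
  have hW2 := hW.integrable_norm_pow two_ne_zero
  set J := ∫ t, ‖G t‖ * ‖U t‖
  have hJ : 0 ≤ J := integral_nonneg fun t => by positivity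
  have h1 := integral_norm_sq_left_le hc hs hh hU hW hG
  have h2 := integral_norm_sq_right_le hc hs hh hU hW hG
  have h3 : ε * ∫ t, ‖W t‖ ^ 2 ≤ (K + 1) / κ * J := by
    rw [div_mul_eq_mul_div, le_div_iff₀ hκ]
    have h4 := mul_le_mul_of_nonneg_left h2 hε.le
    have h5 := mul_le_mul_of_nonneg_left h1 hK.le
    have h6 := mul_le_mul_of_nonneg_right hε1 hJ
    linarith
  unfold energySource
  rw [integral_const_mul]
  refine mul_le_mul_of_nonneg_left ?_ (by positivity)
  have hi : Integrable fun t => ε * (‖U t‖ ^ 2 + ‖W t‖ ^ 2) := (hU2.add hW2).const_mul ε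
  calc ∫ t, (ε * ‖U t‖ + ‖G t‖) * ‖W t‖
      ≤ ∫ t, (ε * (‖U t‖ ^ 2 + ‖W t‖ ^ 2) + ‖G t‖ * ‖W t‖) := by
        refine integral_mono (((hU.norm.const_mul ε).add hG.norm).integrable_mul hW.norm)
          (hi.add hGW) fun t => ?_
        have : ‖U t‖ * ‖W t‖ ≤ ‖U t‖ ^ 2 + ‖W t‖ ^ 2 := by
          nlinarith [sq_nonneg (‖U t‖ - ‖W t‖), sq_nonneg ‖U t‖, sq_nonneg ‖W t‖]
        have := mul_le_mul_of_nonneg_left this hε.le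
        dsimp only
        linarith
    _ = ε * (∫ t, ‖U t‖ ^ 2) + ε * (∫ t, ‖W t‖ ^ 2) + ∫ t, ‖G t‖ * ‖W t‖ := by
        rw [integral_add hi hGW, integral_const_mul, integral_add hU2 hW2, mul_add]
    _ ≤ _ := by linarith

/-- The `L¹ → L^∞` bound for the resolvent, for `ε ≤ 1`. -/
theorem norm_le (hc : EnergyCoeffs A B m κ K)
    (hs : SystemSolution A B h ε G U W) (hh : 0 < h) (hε : 0 < ε) (hε1 : ε ≤ 1)
    (hU : MemLp U 2) (hW : MemLp W 2) (hG : MemLp G 2) (hG1 : Integrable G)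
    {T : ℝ} (hT : ∀ x y, m y - m x ≤ T) (x : ℝ) :
    ‖U x‖ ≤ Real.exp (T / κ) * (2 * K) * (2 + (K + 1) / κ) / κ * h⁻¹ * ∫ t, ‖G t‖ := by
  have hK : 0 < K := hc.pos.trans_le ((hc.left_ge 0).trans (hc.left_le 0))
  have hκ := hc.pos
  set Q := Real.exp (T / κ) * ∫ t, energySource K h ε G U W t with hQ
  have hE := energy_le_integral hc hs hh hε hU hW hG hT
  have hQ0 : 0 ≤ Q := mul_nonneg (Real.exp_pos _).le
    (integral_nonneg fun t => by unfold energySource; positivity)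
  set r := √(Q / κ) with hr
  have hrr : r * r = Q / κ := Real.mul_self_sqrt (div_nonneg hQ0 hκ.le)
  have hUr (t : ℝ) : ‖U t‖ ≤ r := by
    refine Real.le_sqrt_of_sq_le ?_
    rw [le_div_iff₀ hκ]
    have h1 := hE t
    rw [energy] at h1
    have h2 := mul_le_mul_of_nonneg_right (hc.right_ge t) (sq_nonneg ‖U t‖)
    have h3 := mul_nonneg (hκ.le.trans (hc.left_ge t)) (sq_nonneg ‖W t‖)
    linarith
  have hWr (t : ℝ) : ‖W t‖ ≤ r := by
    refine Real.le_sqrt_of_sq_le ?_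
    rw [le_div_iff₀ hκ]
    have h1 := hE t
    rw [energy] at h1
    have h2 := mul_le_mul_of_nonneg_right (hc.left_ge t) (sq_nonneg ‖W t‖)
    have h3 := mul_nonneg (hκ.le.trans (hc.right_ge t)) (sq_nonneg ‖U t‖)
    linarith
  have hJ1 : ∫ t, ‖G t‖ * ‖U t‖ ≤ (∫ t, ‖G t‖) * r := by
    rw [← integral_mul_const]
    exact integral_mono (integrable_norm_mul hG hU) (hG1.norm.mul_const r)
      fun t => mul_le_mul_of_nonneg_left (hUr t) (norm_nonneg _)
  have hJ2 : ∫ t, ‖G t‖ * ‖W t‖ ≤ (∫ t, ‖G t‖) * r := by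
    rw [← integral_mul_const]
    exact integral_mono (integrable_norm_mul hG hW) (hG1.norm.mul_const r)
      fun t => mul_le_mul_of_nonneg_left (hWr t) (norm_nonneg _)
  have h1 : Q ≤ Real.exp (T / κ) * (2 * K / h * ((2 + (K + 1) / κ) * ((∫ t, ‖G t‖) * r))) := by
    refine mul_le_mul_of_nonneg_left ?_ (Real.exp_pos _).le
    refine (integral_energySource_le hc hs hh hε hε1 hU hW hG).trans ?_
    refine mul_le_mul_of_nonneg_left ?_ (by positivity)
    have := mul_le_mul_of_nonneg_left hJ1 (by positivity : 0 ≤ 1 + (K + 1) / κ)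
    linarith
  refine (hUr x).trans ?_
  rcases (Real.sqrt_nonneg (Q / κ)).eq_or_lt with h0 | h0
  · rw [hr, ← h0]
    have : 0 ≤ ∫ t, ‖G t‖ := integral_nonneg fun t => norm_nonneg _
    positivity
  -- The bound on `Q` is linear in `r`, while `Q = κ * r ^ 2`; one factor `r` is divided out.
  · refine le_of_mul_le_mul_right ?_ h0
    rw [← hr, hrr, div_le_iff₀ hκ]
    refine h1.trans_eq ?_
    field_simp

end SystemSolution

/-! ### Variational solutions in the Sobolev space -/

/-- The Lax-Milgram lemma on a closed subspace. -/
theorem exists_galerkin_solution {H : Type*} [NormedAddCommGroup H] [InnerProductSpace ℂ H]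
    (K : Submodule ℂ H) [CompleteSpace K] (M : H →L[ℂ] H) {c : ℝ} (hc : 0 < c)
    (hM : ∀ x ∈ K, c * ‖x‖ ^ 2 ≤ ‖inner ℂ (M x) x‖) :
    ∃ S : H →L[ℂ] H, ∀ f, S f ∈ K ∧ ∀ y ∈ K, inner ℂ y (M (S f) - f) = 0 := by
  let T : K →L[ℂ] K := K.orthogonalProjectionOnto ∘L M ∘L K.subtypeL
  -- Compressing `M` to `K` does not change `⟨M x, x⟩` for `x` in `K`, so coercivity is inherited.
  have hT : IsUnit T := by
    refine ContinuousLinearMap.isUnit_of_forall_le_norm_inner_map T (c := ⟨c, hc.le⟩) hc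
      fun x => ?_
    have : inner ℂ (T x) x = inner ℂ (M x) (x : H) :=
      Submodule.inner_orthogonalProjectionOnto_eq_of_mem_right x (M x)
    rw [this, mul_comm]
    exact hM x x.2
  obtain ⟨S, hS, -⟩ := isUnit_iff_exists.1 hT
  refine ⟨K.subtypeL ∘L S ∘L K.orthogonalProjectionOnto, fun f => ⟨(S _).2, fun y hy => ?_⟩⟩
  have h1 : T (S (K.orthogonalProjectionOnto f)) = K.orthogonalProjectionOnto f :=
    DFunLike.congr_fun hS _
  have h2 := Submodule.inner_orthogonalProjectionOnto_eq_of_mem_left (⟨y, hy⟩ : K)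
    (M (S (K.orthogonalProjectionOnto f)))
  have h3 := Submodule.inner_orthogonalProjectionOnto_eq_of_mem_left (⟨y, hy⟩ : K) f
  rw [inner_sub_right, sub_eq_zero]
  refine h2.symm.trans (Eq.trans ?_ h3)
  exact congrArg _ h1

/-- Multiplication by a bounded measurable function as a bounded operator on `L²(ℝ)`. -/
noncomputable def mulOp (k : ℝ → ℂ) (hk : MemLp k ∞ volume) : L2R →L[ℂ] L2R :=
  (ContinuousLinearMap.mul ℂ ℂ).holderL volume ∞ 2 2 (hk.toLp k)

theorem mulOp_apply (k : ℝ → ℂ) (hk : MemLp k ∞ volume) (f : L2R) :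
    mulOp k hk f =ᵐ[volume] fun x => k x * f x := by
  have h1 := (ContinuousLinearMap.mul ℂ ℂ).coeFn_holder (r := 2) (hk.toLp k) f
  filter_upwards [h1, hk.coeFn_toLp] with x h2 h3
  rw [h3] at h2
  exact h2

theorem L2R.norm_sq_eq_integral (u : L2R) : ‖u‖ ^ 2 = ∫ x, ‖u x‖ ^ 2 := by
  have h : inner ℂ u u = ((∫ x, ‖u x‖ ^ 2 : ℝ) : ℂ) := by
    rw [L2.inner_def]
    refine Eq.trans ?_ (integral_ofReal (𝕜 := ℂ))
    refine integral_congr_ae (Filter.Eventually.of_forall fun x => ?_)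
    dsimp only
    rw [inner_self_eq_norm_sq_to_K]
    push_cast
    rfl
  rw [inner_self_eq_norm_sq_to_K] at h
  refine Complex.ofReal_injective (Eq.trans ?_ h)
  push_cast
  rfl

theorem inner_mulOp_self (b : ℝ → ℝ) (hb : MemLp (fun x => (b x : ℂ)) ∞ volume) (u : L2R) :
    inner ℂ (mulOp _ hb u) u = ((∫ x, b x * ‖u x‖ ^ 2 : ℝ) : ℂ) := by
  rw [L2.inner_def]
  refine Eq.trans ?_ (integral_ofReal (𝕜 := ℂ))
  refine integral_congr_ae ?_
  filter_upwards [mulOp_apply _ hb u] with x hx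
  rw [hx, ← smul_eq_mul, inner_smul_left, inner_self_eq_norm_sq_to_K]
  push_cast
  simp

theorem integrable_mul_norm_sq {b : ℝ → ℝ} {k : ℝ} (hb : Measurable b) (hk : ∀ x, |b x| ≤ k)
    (u : L2R) : Integrable fun x => b x * ‖u x‖ ^ 2 :=
  ((Lp.memLp u).integrable_norm_pow two_ne_zero).bdd_mul (c := k) hb.aestronglyMeasurable
    (Filter.Eventually.of_forall hk)

theorem le_integral_mul_norm_sq {b : ℝ → ℝ} {k c : ℝ} (hb : Measurable b) (hk : ∀ x, |b x| ≤ k)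
    (hc : ∀ x, c ≤ b x) (u : L2R) : c * ‖u‖ ^ 2 ≤ ∫ x, b x * ‖u x‖ ^ 2 := by
  rw [L2R.norm_sq_eq_integral, ← integral_const_mul]
  exact integral_mono (((Lp.memLp u).integrable_norm_pow two_ne_zero).const_mul c)
    (integrable_mul_norm_sq hb hk u) fun x => mul_le_mul_of_nonneg_right (hc x) (sq_nonneg _)

theorem memLp_top_ofReal {b : ℝ → ℝ} {k : ℝ} (hb : Measurable b) (hk : ∀ x, |b x| ≤ k) :
    MemLp (fun x => (b x : ℂ)) ∞ volume :=
  memLp_top_of_bound (Complex.measurable_ofReal.comp hb).aestronglyMeasurable k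
    (Filter.Eventually.of_forall fun x => by
      rw [Complex.norm_real]
      exact hk x)

theorem HasWeakDeriv.congr_deriv {u v v' : ℝ → ℂ} (h : HasWeakDeriv u v)
    (hv : v =ᵐ[volume] v') : HasWeakDeriv u v' := by
  refine ⟨h.1, h.2.1.congr hv, fun φ hφ hc => ?_⟩
  rw [h.2.2 φ hφ hc]
  exact congrArg _ (integral_congr_ae (hv.mono fun x hx => by simp only [hx]))

/-- A continuous compactly supported function as an element of `L²(ℝ)`. -/
noncomputable def testL2 (φ : ℝ → ℝ) (hφ : Continuous φ) (hc : HasCompactSupport φ) : L2R :=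
  MemLp.toLp (fun x => (φ x : ℂ)) ((Complex.continuous_ofReal.comp hφ).memLp_of_hasCompactSupport
    (hc.comp_left (g := Complex.ofReal) Complex.ofReal_zero))

theorem testL2_apply (φ : ℝ → ℝ) (hφ : Continuous φ) (hc : HasCompactSupport φ) :
    testL2 φ hφ hc =ᵐ[volume] fun x => (φ x : ℂ) :=
  MemLp.coeFn_toLp _

theorem inner_testL2 (φ : ℝ → ℝ) (hφ : Continuous φ) (hc : HasCompactSupport φ) (u : L2R) :
    inner ℂ (testL2 φ hφ hc) u = ∫ x, φ x • u x := by
  rw [L2.inner_def]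
  refine integral_congr_ae ?_
  filter_upwards [testL2_apply φ hφ hc] with x hx
  rw [hx]
  simp [mul_comm]

/-- The pair `(φ', φ)` in `L² × L²`, for a test function `φ`. -/
noncomputable def testPair (φ : {φ : ℝ → ℝ // ContDiff ℝ ∞ φ ∧ HasCompactSupport φ}) :
    WithLp 2 (L2R × L2R) :=
  WithLp.toLp 2 (testL2 (deriv φ.1) (φ.2.1.continuous_deriv (by simp)) φ.2.2.deriv,
    testL2 φ.1 φ.2.1.continuous φ.2.2)

/-- The Sobolev space `H¹(ℝ)`, as the space of pairs `(u, u')` in `L² × L²`. -/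
noncomputable def sobolevGraph : Submodule ℂ (WithLp 2 (L2R × L2R)) :=
  (Submodule.span ℂ (range testPair))ᗮ

noncomputable instance : CompleteSpace sobolevGraph :=
  (Submodule.isClosed_orthogonal _).completeSpace_coe

theorem L2R.locallyIntegrable (u : L2R) : LocallyIntegrable (u : ℝ → ℂ) :=
  (Lp.memLp u).locallyIntegrable (by norm_num)

/-- Orthogonality to `(φ', φ)` says exactly `∫ φ' u + ∫ φ v = 0`. Defining the space as an
orthogonal complement makes its completeness immediate. -/
theorem mem_sobolevGraph {x : WithLp 2 (L2R × L2R)} :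
    x ∈ sobolevGraph ↔ HasWeakDeriv x.fst x.snd := by
  have key : ∀ φ, inner ℂ (testPair φ) x = (∫ t, deriv φ.1 t • x.fst t) + ∫ t, φ.1 t • x.snd t :=
    fun φ => by
      rw [WithLp.prod_inner_apply]
      exact congrArg₂ _
        (inner_testL2 _ (φ.2.1.continuous_deriv (by simp)) φ.2.2.deriv x.fst)
        (inner_testL2 _ φ.2.1.continuous φ.2.2 x.snd)
  constructor
  · intro hx
    refine ⟨L2R.locallyIntegrable _, L2R.locallyIntegrable _, fun φ hφ hc => ?_⟩
    have := (Submodule.mem_orthogonal _ _).1 hx _ (Submodule.subset_span ⟨⟨φ, hφ, hc⟩, rfl⟩)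
    rw [key] at this
    exact eq_neg_of_add_eq_zero_left this
  · intro hx
    refine (Submodule.mem_orthogonal _ _).2 fun u hu => ?_
    induction hu using Submodule.span_induction with
    | mem u hu =>
      obtain ⟨φ, rfl⟩ := hu
      rw [key, hx.2.2 φ.1 φ.2.1 φ.2.2, neg_add_cancel]
    | zero => exact inner_zero_left _
    | add u v _ _ hu hv => rw [inner_add_left, hu, hv, add_zero]
    | smul c u _ hu => rw [inner_smul_left, hu, mul_zero]

theorem toLp_testL2_mem_sobolevGraph {φ : ℝ → ℝ} (hφ : ContDiff ℝ ∞ φ)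
    (hc : HasCompactSupport φ) :
    WithLp.toLp 2 (testL2 φ hφ.continuous hc,
      testL2 (deriv φ) (hφ.continuous_deriv (by simp)) hc.deriv) ∈ sobolevGraph := by
  rw [mem_sobolevGraph]
  have hd : Continuous (deriv φ) := hφ.continuous_deriv (by simp)
  exact (((IsPrimitive.of_contDiff hφ).clm_apply Complex.ofRealCLM).hasWeakDeriv.congr
    (testL2_apply φ hφ.continuous hc).symm).congr_deriv (testL2_apply _ hd hc.deriv).symm

/-- This reads the differential equation off the variational one, by testing with the pairs `(φ,
φ')`. -/
theorem hasWeakDeriv_of_forall_mem_sobolevGraph {p q : L2R}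
    (h : ∀ y ∈ sobolevGraph, inner ℂ y (WithLp.toLp 2 (p, q)) = 0) : HasWeakDeriv q p := by
  refine ⟨L2R.locallyIntegrable _, L2R.locallyIntegrable _, fun φ hφ hc => ?_⟩
  have := h _ (toLp_testL2_mem_sobolevGraph hφ hc)
  rw [WithLp.prod_inner_apply] at this
  have e : (∫ x, φ x • p x) + ∫ x, deriv φ x • q x = 0 := by
    rw [← inner_testL2 φ hφ.continuous hc, ← inner_testL2 _ (hφ.continuous_deriv (by simp))
      hc.deriv]
    exact this
  exact eq_neg_of_add_eq_zero_right e

/-- The variational solution of `-(a u')' + b u - i ε u = f`. -/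
theorem exists_variational_solution {a b : ℝ → ℝ} {k a₀ ε : ℝ} (ha : Measurable a)
    (hb : Measurable b) (hak : ∀ x, |a x| ≤ k) (hbk : ∀ x, |b x| ≤ k) (ha₀ : 0 < a₀)
    (haa : ∀ x, a₀ ≤ a x) (hε : 0 < ε) :
    ∃ R : L2R →L[ℂ] L2R, ∀ f, ∃ v : L2R, HasWeakDeriv (R f) v ∧
      HasWeakDeriv (fun x => (a x : ℂ) * v x)
        (fun x => (b x : ℂ) * R f x - Complex.I * ε * R f x - f x) := by
  have hk : 0 ≤ k := (abs_nonneg _).trans (hak 0)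
  let Mb := mulOp _ (memLp_top_ofReal hb hbk)
  let Ma := mulOp _ (memLp_top_ofReal ha hak)
  let N : L2R →L[ℂ] L2R := Mb - (Complex.I * ε : ℂ) • ContinuousLinearMap.id ℂ L2R
  let e := WithLp.prodContinuousLinearEquiv 2 ℂ L2R L2R
  let M : WithLp 2 (L2R × L2R) →L[ℂ] WithLp 2 (L2R × L2R) :=
    (e.symm : L2R × L2R →L[ℂ] WithLp 2 (L2R × L2R)) ∘L (N.prodMap Ma) ∘L
      (e : WithLp 2 (L2R × L2R) →L[ℂ] L2R × L2R)
  have hin (x : WithLp 2 (L2R × L2R)) : inner ℂ (M x) x =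
      (((∫ t, b t * ‖x.fst t‖ ^ 2) + ∫ t, a t * ‖x.snd t‖ ^ 2 : ℝ) : ℂ) +
        Complex.I * ((ε * ‖x.fst‖ ^ 2 : ℝ) : ℂ) := by
    have h1 : inner ℂ (M x) x = inner ℂ (N x.fst) x.fst + inner ℂ (Ma x.snd) x.snd := rfl
    have h2 : inner ℂ (N x.fst) x.fst = inner ℂ (Mb x.fst) x.fst +
        Complex.I * ((ε * ‖x.fst‖ ^ 2 : ℝ) : ℂ) := by
      have : N x.fst = Mb x.fst - (Complex.I * ε : ℂ) • x.fst := rfl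
      rw [this, inner_sub_left, inner_smul_left, inner_self_eq_norm_sq_to_K]
      simp
      ring
    rw [h1, h2, inner_mulOp_self, inner_mulOp_self]
    push_cast
    ring
  -- The imaginary part of the form controls `ε‖u‖²` and the real part controls `a₀‖u'‖² - k‖u‖²`.
  -- Adding `(k + a₀) / ε` times the first bound to the second gives this constant.
  have hlow (x : WithLp 2 (L2R × L2R)) :
      a₀ / (1 + (k + a₀) / ε) * ‖x‖ ^ 2 ≤ ‖inner ℂ (M x) x‖ := by
    have h1 : ε * ‖x.fst‖ ^ 2 ≤ ‖inner ℂ (M x) x‖ := by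
      refine le_trans ?_ ((le_abs_self _).trans (Complex.abs_im_le_norm _))
      rw [hin, Complex.add_im, Complex.ofReal_im, Complex.I_mul_im, Complex.ofReal_re, zero_add]
    have h2 : a₀ * ‖x.snd‖ ^ 2 - k * ‖x.fst‖ ^ 2 ≤ ‖inner ℂ (M x) x‖ := by
      refine le_trans ?_ ((le_abs_self _).trans (Complex.abs_re_le_norm _))
      rw [hin, Complex.add_re, Complex.ofReal_re, Complex.I_mul_re, Complex.ofReal_im, neg_zero,
        add_zero]
      have h3 := le_integral_mul_norm_sq ha hak haa x.snd
      have h4 := le_integral_mul_norm_sq hb hbk (fun t => (abs_le.1 (hbk t)).1) x.fst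
      linarith
    have h3 := mul_le_mul_of_nonneg_left h1 (by positivity : 0 ≤ (k + a₀) / ε)
    have h4 : (k + a₀) / ε * (ε * ‖x.fst‖ ^ 2) = (k + a₀) * ‖x.fst‖ ^ 2 := by field_simp
    rw [div_mul_eq_mul_div, div_le_iff₀ (by positivity), WithLp.prod_norm_sq_eq_of_L2]
    linarith
  obtain ⟨S, hS⟩ := exists_galerkin_solution sobolevGraph M
    (c := a₀ / (1 + (k + a₀) / ε)) (by positivity) fun x _ => hlow x
  let J : L2R →L[ℂ] WithLp 2 (L2R × L2R) :=
    (e.symm : L2R × L2R →L[ℂ] WithLp 2 (L2R × L2R)) ∘L ContinuousLinearMap.inl ℂ L2R L2R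
  refine ⟨WithLp.fstL 2 ℂ L2R L2R ∘L S ∘L J, fun f => ⟨(S (J f)).snd, ?_, ?_⟩⟩
  · exact mem_sobolevGraph.1 (hS (J f)).1
  · set w := S (J f) with hw
    have h1 : M w - J f = WithLp.toLp 2 (N w.fst - f, Ma w.snd) := by
      have : M w - J f = WithLp.toLp 2 (N w.fst - f, Ma w.snd - 0) := rfl
      rw [this, sub_zero]
    have h2 := hasWeakDeriv_of_forall_mem_sobolevGraph (p := N w.fst - f) (q := Ma w.snd)
      fun y hy => h1 ▸ (hS (J f)).2 y hy
    refine (h2.congr (mulOp_apply _ _ _)).congr_deriv ?_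
    have h3 : N w.fst = Mb w.fst - (Complex.I * ε : ℂ) • w.fst := rfl
    rw [h3]
    filter_upwards [Lp.coeFn_sub (Mb w.fst - (Complex.I * ε : ℂ) • w.fst) f,
      Lp.coeFn_sub (Mb w.fst) ((Complex.I * ε : ℂ) • w.fst),
      Lp.coeFn_smul (Complex.I * ε : ℂ) w.fst, mulOp_apply _ (memLp_top_ofReal hb hbk) w.fst]
      with x g1 g2 g3 g4
    rw [g1, Pi.sub_apply, g2, Pi.sub_apply, g3, Pi.smul_apply, g4]
    rfl

/-! ### From the system to the resolvent -/

open Filter Topology ComplexConjugate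

/-- The Sobolev embedding `H¹(ℝ) ⊆ L^∞(ℝ)`. -/
theorem IsPrimitive.memLp_top {U U' : ℝ → ℂ} (h : IsPrimitive U U') (hU : MemLp U 2)
    (hU' : MemLp U' 2) : MemLp U ∞ := by
  have hi : Integrable fun x => 2 * (U' x * conj (U x)).re :=
    (Complex.reCLM.integrable_comp
      (SystemSolution.integrable_mul_conj hU' hU)).const_mul 2
  have h0 := h.normSq.tendsto_atBot (hU.integrable_norm_pow two_ne_zero) hi
  set N := ∫ x, ‖2 * (U' x * conj (U x)).re‖
  refine memLp_top_of_bound hU.1 √N (Eventually.of_forall fun x => Real.le_sqrt_of_sq_le ?_)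
  have h1 := h0.add_const N
  rw [zero_add] at h1
  refine ge_of_tendsto h1 ((eventually_le_atBot x).mono fun a ha => ?_)
  rw [← sub_le_iff_le_add', ← h.normSq.2, intervalIntegral.integral_of_le ha]
  refine (Real.le_norm_self _).trans ((norm_integral_le_integral_norm _).trans ?_)
  exact setIntegral_le_integral hi.norm (Eventually.of_forall fun t => norm_nonneg _)

theorem HasWeakDeriv.memLp_top {u v : ℝ → ℂ} (h : HasWeakDeriv u v) (hu : MemLp u 2)
    (hv : MemLp v 2) : MemLp u ∞ := by
  obtain ⟨U, hU, hp⟩ := h.exists_isPrimitive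
  exact (hp.memLp_top (hu.ae_eq hU) hv).ae_eq hU.symm

/-- A pair `(u, P u)` in the graph of the operator gives a solution of the first order system. -/
theorem exists_systemSolution {α V : ℝ → ℝ} {E h ε a₀ a₁ : ℝ} (hα : Measurable α)
    (ha₀ : 0 < a₀) (hα₀ : ∀ x, a₀ ≤ α x) (hα₁ : ∀ x, α x ≤ a₁) (hh : 0 < h) {u g : L2R}
    (hp : (u, g + (Complex.I * ε) • u) ∈ schrodingerGraph α V E h) :
    ∃ U W : ℝ → ℂ, u =ᵐ[volume] U ∧ MemLp W 2 ∧
      SystemSolution (fun x => (α x)⁻¹) (fun x => E - V x) h ε g U W := by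
  obtain ⟨-, u₁, u₂, hu, hu1, -, hw, hg⟩ := hp
  dsimp only at hu hg
  obtain ⟨U, hU, hUp⟩ := hu.exists_isPrimitive
  obtain ⟨W, hW, hWp⟩ := hw.exists_isPrimitive
  have hh' : (h : ℂ) ≠ 0 := by exact_mod_cast hh.ne'
  refine ⟨U, W, hU, MemLp.ae_eq hW ?_, hUp.congr_deriv ?_, hWp.congr_deriv ?_⟩
  · refine (hu1.const_mul (h : ℂ)).of_le_mul (c := a₁)
      ((Complex.measurable_ofReal.comp hα).aestronglyMeasurable.mul
        (hu1.const_mul (h : ℂ)).1) (Eventually.of_forall fun x => ?_)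
    rw [norm_mul, Complex.norm_real, Real.norm_of_nonneg (ha₀.le.trans (hα₀ x))]
    exact mul_le_mul_of_nonneg_right (hα₁ x) (norm_nonneg _)
  · filter_upwards [hW] with x hx
    have : (α x : ℂ) ≠ 0 := by exact_mod_cast (ha₀.trans_le (hα₀ x)).ne'
    rw [← hx]
    push_cast
    field_simp
  · filter_upwards [hg, hU, Lp.coeFn_add g ((Complex.I * ε : ℂ) • u),
      Lp.coeFn_smul (Complex.I * ε : ℂ) u] with x h1 h2 h3 h4
    rw [h3, Pi.add_apply, h4, Pi.smul_apply, smul_eq_mul, h2] at h1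
    rw [eq_div_iff hh']
    push_cast
    linear_combination h1

theorem exists_mem_schrodingerGraph {α V : ℝ → ℝ} {E h ε a₀ a₁ k : ℝ} (hα : Measurable α)
    (hV : Measurable V) (ha₀ : 0 < a₀) (hα₀ : ∀ x, a₀ ≤ α x) (hα₁ : ∀ x, α x ≤ a₁)
    (hk : ∀ x, |V x - E| ≤ k) (hh : 0 < h) (hε : 0 < ε) :
    ∃ R : L2R →L[ℂ] L2R, ∀ g, (R g, g + (Complex.I * ε) • R g) ∈ schrodingerGraph α V E h := by
  have hh' : (h : ℂ) ≠ 0 := by exact_mod_cast hh.ne'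
  obtain ⟨R, hR⟩ := exists_variational_solution (a := fun x => α x * h ^ 2) (b := fun x => V x - E)
    (k := max (a₁ * h ^ 2) k) (a₀ := a₀ * h ^ 2) (ε := ε) (hα.mul_const _) (hV.sub_const _)
    (fun x => by
      rw [abs_of_pos (mul_pos (ha₀.trans_le (hα₀ x)) (by positivity))]
      exact (mul_le_mul_of_nonneg_right (hα₁ x) (by positivity)).trans (le_max_left _ _))
    (fun x => (hk x).trans (le_max_right _ _)) (by positivity)
    (fun x => mul_le_mul_of_nonneg_right (hα₀ x) (by positivity)) hε
  refine ⟨R, fun g => ?_⟩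
  obtain ⟨v, h1, h2⟩ := hR g
  have hkL : MemLp (fun x => ((V x - E : ℝ) : ℂ) * R g x) 2 := by
    refine (Lp.memLp (R g)).of_le_mul (c := k)
      ((Complex.measurable_ofReal.comp (hV.sub_const E)).aestronglyMeasurable.mul
        (Lp.memLp (R g)).1) (Eventually.of_forall fun x => ?_)
    rw [norm_mul, Complex.norm_real]
    exact mul_le_mul_of_nonneg_right (hk x) (norm_nonneg _)
  have hvL : MemLp (fun x => ((α x * h ^ 2 : ℝ) : ℂ) * v x) 2 := by
    refine (Lp.memLp v).of_le_mul (c := a₁ * h ^ 2)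
      ((Complex.measurable_ofReal.comp (hα.mul_const _)).aestronglyMeasurable.mul
        (Lp.memLp v).1) (Eventually.of_forall fun x => ?_)
    rw [norm_mul, Complex.norm_real,
      Real.norm_of_nonneg (mul_nonneg (ha₀.le.trans (hα₀ x)) (by positivity))]
    exact mul_le_mul_of_nonneg_right (mul_le_mul_of_nonneg_right (hα₁ x) (by positivity))
      (norm_nonneg _)
  -- The domain requires `u'` to be bounded. The flux `α h² u'` is in `H¹`, hence bounded, and `α
  -- h²` is bounded below.
  have htop := h2.memLp_top hvL
    ((hkL.sub ((Lp.memLp (R g)).const_mul (Complex.I * ε))).sub (Lp.memLp g))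
  refine ⟨h1.memLp_top (Lp.memLp _) (Lp.memLp _), v,
    fun x => (h : ℂ)⁻¹ * (((V x - E : ℝ) : ℂ) * R g x - Complex.I * ε * R g x - g x), h1,
    Lp.memLp v, ?_, ?_, ?_⟩
  · refine htop.of_le_mul (c := (a₀ * h ^ 2)⁻¹) (Lp.memLp v).1 (Eventually.of_forall fun x => ?_)
    rw [norm_mul, Complex.norm_real,
      Real.norm_of_nonneg (mul_nonneg (ha₀.le.trans (hα₀ x)) (by positivity)),
      inv_mul_eq_div, le_div_iff₀ (by positivity), mul_comm]
    exact mul_le_mul_of_nonneg_right (mul_le_mul_of_nonneg_right (hα₀ x) (by positivity))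
      (norm_nonneg _)
  · convert h2.const_mul ((h : ℂ)⁻¹) using 2 with x
    push_cast
    field_simp
  · dsimp only
    filter_upwards [Lp.coeFn_add g ((Complex.I * ε : ℂ) • R g),
      Lp.coeFn_smul (Complex.I * ε : ℂ) (R g)] with x h3 h4
    rw [h3, Pi.add_apply, h4, Pi.smul_apply, smul_eq_mul]
    push_cast
    field_simp
    ring

theorem integral_norm_mul_norm_le {f g : ℝ → ℂ} (hf : MemLp f 2) (hg : MemLp g 2) :
    ∫ x, ‖f x‖ * ‖g x‖ ≤ ‖hf.toLp f‖ * ‖hg.toLp g‖ := by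
  have h1 := real_inner_le_norm (hf.norm.toLp _) (hg.norm.toLp _)
  rw [L2.inner_def] at h1
  have h2 : ∫ x, inner ℝ (hf.norm.toLp _ x) (hg.norm.toLp _ x) = ∫ x, ‖f x‖ * ‖g x‖ := by
    refine integral_congr_ae ?_
    filter_upwards [hf.norm.coeFn_toLp, hg.norm.coeFn_toLp] with x h3 h4
    rw [h3, h4]
    simp [mul_comm]
  rw [h2] at h1
  simpa [Lp.norm_toLp, eLpNorm_norm] using h1

/-- The imaginary part of the energy identity and Cauchy–Schwarz give `ε‖u‖² ≤ ‖g‖‖u‖`. This serves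
twice: with `g = 0` for uniqueness, and as the resolvent bound when `ε > 1`. -/
theorem norm_le_of_mem_schrodingerGraph {α V m : ℝ → ℝ} {E h ε a₀ a₁ κ K : ℝ}
    (hα : Measurable α) (ha₀ : 0 < a₀) (hα₀ : ∀ x, a₀ ≤ α x) (hα₁ : ∀ x, α x ≤ a₁)
    (hc : EnergyCoeffs (fun x => (α x)⁻¹) (fun x => E - V x) m κ K) (hh : 0 < h)
    {u g : L2R} (hp : (u, g + (Complex.I * ε) • u) ∈ schrodingerGraph α V E h) :
    ε * ‖u‖ ≤ ‖g‖ := by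
  obtain ⟨U, W, hU, hW, hs⟩ := exists_systemSolution hα ha₀ hα₀ hα₁ hh hp
  have hUL : MemLp U 2 := (Lp.memLp u).ae_eq hU
  have h1 := SystemSolution.integral_norm_sq_left_le hc hs hh hUL hW (Lp.memLp g)
  have h2 := integral_norm_mul_norm_le (Lp.memLp g) hUL
  have h3 : hUL.toLp U = u := by
    rw [MemLp.toLp_congr hUL (Lp.memLp u) hU.symm, Lp.toLp_coeFn]
  have h4 : ∫ t, ‖U t‖ ^ 2 = ‖u‖ ^ 2 := by
    rw [L2R.norm_sq_eq_integral]
    exact integral_congr_ae (hU.mono fun x hx => by simp only [hx])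
  rw [h3, Lp.toLp_coeFn] at h2
  rw [h4] at h1
  rcases (norm_nonneg u).eq_or_lt with h0 | h0
  · rw [← h0, mul_zero]
    exact norm_nonneg _
  · refine le_of_mul_le_mul_right ?_ h0
    linarith

theorem isResolventAt_of_forall_mem_schrodingerGraph {α V m : ℝ → ℝ} {E h ε a₀ a₁ κ K : ℝ}
    (hα : Measurable α) (ha₀ : 0 < a₀) (hα₀ : ∀ x, a₀ ≤ α x) (hα₁ : ∀ x, α x ≤ a₁)
    (hc : EnergyCoeffs (fun x => (α x)⁻¹) (fun x => E - V x) m κ K) (hh : 0 < h) (hε : 0 < ε)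
    {R : L2R →L[ℂ] L2R}
    (hR : ∀ g, (R g, g + (Complex.I * ε) • R g) ∈ schrodingerGraph α V E h) :
    IsResolventAt (schrodingerOp α V E h) (Complex.I * ε) R := by
  refine ⟨fun g => ?_, fun u => ?_⟩
  · have h1 := hR g
    rw [← schrodingerOp_graph] at h1
    have hd := LinearPMap.mem_domain_of_mem_graph h1
    refine ⟨hd, ?_⟩
    rw [← (LinearPMap.image_iff hd).2 h1, add_sub_cancel_right]
  · have h1 := LinearPMap.mem_graph _ u
    rw [schrodingerOp_graph] at h1
    have h2 := sub_mem h1 (hR (schrodingerOp α V E h u - (Complex.I * ε) • (u : L2R)))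
    have h3 := norm_le_of_mem_schrodingerGraph (ε := ε) (g := 0) hα ha₀ hα₀ hα₁ hc hh
      (u := u - R (schrodingerOp α V E h u - (Complex.I * ε) • (u : L2R))) (by
        convert h2 using 1
        rw [Prod.mk_sub_mk, smul_sub]
        congr 1
        abel)
    rw [norm_zero] at h3
    have h4 : ‖(u : L2R) - R (schrodingerOp α V E h u - (Complex.I * ε) • (u : L2R))‖ = 0 :=
      le_antisymm (nonpos_of_mul_nonpos_right h3 hε) (norm_nonneg _)
    exact (sub_eq_zero.1 (norm_eq_zero.1 h4)).symm

/-! ### Coefficients of bounded variation -/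

theorem BoundedVariationOn.measurable {f : ℝ → ℝ} (hf : BoundedVariationOn f univ) :
    Measurable f := by
  obtain ⟨p, q, hp, hq, rfl⟩ := hf.locallyBoundedVariationOn.exists_monotoneOn_sub_monotoneOn
  exact (monotoneOn_univ.1 hp).measurable.sub (monotoneOn_univ.1 hq).measurable

theorem BoundedVariationOn.abs_le {f : ℝ → ℝ} (hf : BoundedVariationOn f univ) (x : ℝ) :
    |f x| ≤ |f 0| + (eVariationOn f univ).toReal := by
  have h := hf.dist_le (mem_univ x) (mem_univ 0)
  rw [Real.dist_eq] at h
  have := abs_sub_abs_le_abs_sub (f x) (f 0)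
  linarith

theorem abs_sub_le_variationOnFromTo {f : ℝ → ℝ} (hf : BoundedVariationOn f univ) {x y : ℝ}
    (hxy : x ≤ y) :
    |f y - f x| ≤ variationOnFromTo f univ 0 y - variationOnFromTo f univ 0 x := by
  have hl := hf.locallyBoundedVariationOn
  rw [variationOnFromTo.sub_right hl (mem_univ _) (mem_univ _) (mem_univ _),
    variationOnFromTo.eq_of_le _ _ hxy, univ_inter]
  have h := (hf.mono (subset_univ (Icc x y))).dist_le (right_mem_Icc.2 hxy) (left_mem_Icc.2 hxy)
  rwa [Real.dist_eq] at h

theorem variationOnFromTo_sub_le {f : ℝ → ℝ} (hf : BoundedVariationOn f univ) (x y : ℝ) :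
    variationOnFromTo f univ 0 y - variationOnFromTo f univ 0 x ≤
      (eVariationOn f univ).toReal := by
  rw [variationOnFromTo.sub_right hf.locallyBoundedVariationOn (mem_univ _) (mem_univ _)
    (mem_univ _)]
  exact (le_abs_self _).trans (variationOnFromTo.abs_le_eVariationOn hf)

theorem exists_energyCoeffs {α V : ℝ → ℝ} {Emin Emax : ℝ}
    (hα : BoundedVariationOn α univ) (hV : BoundedVariationOn V univ) {a₀ v₁ : ℝ} (ha₀ : 0 < a₀)
    (hα₀ : ∀ x, a₀ ≤ α x) (hv₁ : ∀ x, V x ≤ v₁) (hv₁E : v₁ < Emin) :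
    ∃ (m : ℝ → ℝ) (κ K T : ℝ), (∀ x y, m y - m x ≤ T) ∧ ∀ E ∈ Icc Emin Emax,
      EnergyCoeffs (fun x => (α x)⁻¹) (fun x => E - V x) m κ K := by
  set a₁ := |α 0| + (eVariationOn α univ).toReal
  set v₂ := |V 0| + (eVariationOn V univ).toReal
  have hα₁ (x : ℝ) : α x ≤ a₁ := (le_abs_self _).trans (hα.abs_le x)
  have hv₂ (x : ℝ) : -v₂ ≤ V x := (abs_le.1 (hV.abs_le x)).1
  have hα0 (x : ℝ) : 0 < α x := ha₀.trans_le (hα₀ x)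
  have ha₁ : 0 < a₁ := (hα0 0).trans_le (hα₁ 0)
  have hsub {x y : ℝ} (hxy : x ≤ y) := abs_sub_le_variationOnFromTo hα hxy
  have hsub' {x y : ℝ} (hxy : x ≤ y) := abs_sub_le_variationOnFromTo hV hxy
  -- The factor `a₀ ^ 2` comes from `|1/α(y) - 1/α(x)| ≤ |α(y) - α(x)| / a₀ ^ 2`. The energy `E`
  -- cancels in increments of `E - V`, so `m` and `T` do not depend on it.
  refine ⟨fun x => variationOnFromTo α univ 0 x / a₀ ^ 2 + variationOnFromTo V univ 0 x,
    min a₁⁻¹ (Emin - v₁), max a₀⁻¹ (Emax + v₂),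
    (eVariationOn α univ).toReal / a₀ ^ 2 + (eVariationOn V univ).toReal, fun x y => ?_,
    fun E hE' => ?_⟩
  · have h1 := div_le_div_of_nonneg_right (variationOnFromTo_sub_le hα x y) (sq_nonneg a₀)
    have h2 := variationOnFromTo_sub_le hV x y
    rw [sub_div] at h1
    linarith
  · have key {x y : ℝ} (hxy : x ≤ y) : |α y - α x| / a₀ ^ 2 + |V y - V x| ≤
        (variationOnFromTo α univ 0 y / a₀ ^ 2 + variationOnFromTo V univ 0 y) -
        (variationOnFromTo α univ 0 x / a₀ ^ 2 + variationOnFromTo V univ 0 x) := by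
      have h1 := div_le_div_of_nonneg_right (hsub hxy) (sq_nonneg a₀)
      have h2 := hsub' hxy
      rw [sub_div] at h1
      linarith
    refine ⟨lt_min (inv_pos.2 ha₁) (sub_pos.2 hv₁E), fun x => (min_le_left _ _).trans ?_,
      fun x => le_trans ?_ (le_max_left _ _), fun x => (min_le_right _ _).trans ?_,
      fun x => le_trans ?_ (le_max_right _ _), hα.measurable.inv,
      hV.measurable.const_sub E, fun x y hxy => ?_, fun x y hxy => ?_, fun x y hxy => ?_⟩
    · exact inv_anti₀ (hα0 x) (hα₁ x)
    · exact inv_anti₀ ha₀ (hα₀ x)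
    · linarith [hv₁ x, hE'.1]
    · linarith [hv₂ x, hE'.2]
    · have := key hxy
      have h3 : 0 ≤ |α y - α x| / a₀ ^ 2 + |V y - V x| := by positivity
      linarith
    · refine le_trans ?_ (key hxy)
      have h1 : (α y)⁻¹ - (α x)⁻¹ = -(α y - α x) / (α y * α x) := by
        have := (hα0 x).ne'
        have := (hα0 y).ne'
        field_simp
        ring
      rw [h1, abs_div, abs_neg, abs_of_pos (mul_pos (hα0 y) (hα0 x))]
      have h2 : a₀ ^ 2 ≤ α y * α x := by
        rw [sq]
        exact mul_le_mul (hα₀ y) (hα₀ x) ha₀.le (hα0 y).le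
      have h3 := div_le_div_of_nonneg_left (abs_nonneg (α y - α x)) (by positivity) h2
      linarith [abs_nonneg (V y - V x)]
    · refine le_trans ?_ (key hxy)
      have h1 : (E - V y) - (E - V x) = -(V y - V x) := by ring
      rw [h1, abs_neg]
      have : 0 ≤ |α y - α x| / a₀ ^ 2 := by positivity
      linarith

/-! ### The weight and the final estimate -/

/-- The square of the weight is `(|x| + 1) ^ (-(1 + δ))`, integrable because `1 + δ > 1`. Thus the
weight maps `L²` to `L¹` and `L^∞` to `L²`. -/
theorem memLp_two_weight {δ : ℝ} (hδ : 0 < δ) :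
    MemLp (fun x : ℝ => (((|x| + 1) ^ (-((1 + δ) / 2)) : ℝ) : ℂ)) 2 := by
  have hm : Measurable fun x : ℝ => (((|x| + 1) ^ (-((1 + δ) / 2)) : ℝ) : ℂ) := by fun_prop
  rw [memLp_two_iff_integrable_sq_norm hm.aestronglyMeasurable]
  have h := integrable_one_add_norm (E := ℝ) (μ := volume) (r := 1 + δ) (by simpa using hδ)
  refine h.congr (Eventually.of_forall fun x => ?_)
  have hx : 0 < |x| + 1 := by positivity
  dsimp only
  rw [Real.norm_eq_abs, Complex.norm_real, Real.norm_of_nonneg (by positivity),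
    ← Real.rpow_natCast, ← Real.rpow_mul hx.le, add_comm]
  congr 1
  push_cast
  ring

theorem norm_weightOp_le (s : ℝ) (hs : 0 ≤ s) (f : L2R) : ‖weightOp s hs f‖ ≤ ‖f‖ := by
  rw [← one_mul ‖f‖]
  refine Lp.norm_le_mul_norm_of_ae_le_mul ?_
  filter_upwards [weightOp_apply s hs f] with x hx
  have h1 : (1 : ℝ) ≤ |x| + 1 := by linarith [abs_nonneg x]
  rw [hx, norm_mul, Complex.norm_real, Real.norm_of_nonneg (by positivity)]
  exact mul_le_mul_of_nonneg_right
    (Real.rpow_le_one_of_one_le_of_nonpos h1 (by linarith)) (norm_nonneg _)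

theorem norm_weightOp_le_of_bound {δ : ℝ} (hδ : 0 < δ) (hs : 0 ≤ (1 + δ) / 2) {u : L2R} {S : ℝ}
    (hu : ∀ᵐ x, ‖u x‖ ≤ S) :
    ‖weightOp ((1 + δ) / 2) hs u‖ ≤ S * ‖(memLp_two_weight hδ).toLp _‖ := by
  refine Lp.norm_le_mul_norm_of_ae_le_mul ?_
  filter_upwards [weightOp_apply _ hs u, (memLp_two_weight hδ).coeFn_toLp, hu] with x h1 h2 h3
  rw [h1, h2, norm_mul, mul_comm]
  exact mul_le_mul_of_nonneg_right h3 (norm_nonneg _)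

theorem integrable_weightOp {δ : ℝ} (hδ : 0 < δ) (hs : 0 ≤ (1 + δ) / 2) (f : L2R) :
    Integrable (weightOp ((1 + δ) / 2) hs f : ℝ → ℂ) :=
  ((memLp_two_weight hδ).integrable_mul (Lp.memLp f)).congr (weightOp_apply _ hs f).symm

theorem integral_norm_weightOp_le {δ : ℝ} (hδ : 0 < δ) (hs : 0 ≤ (1 + δ) / 2) (f : L2R) :
    ∫ x, ‖weightOp ((1 + δ) / 2) hs f x‖ ≤ ‖(memLp_two_weight hδ).toLp _‖ * ‖f‖ := by
  have h := integral_norm_mul_norm_le (memLp_two_weight hδ) (Lp.memLp f)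
  rw [Lp.toLp_coeFn] at h
  refine le_trans (le_of_eq (integral_congr_ae ?_)) h
  filter_upwards [weightOp_apply _ hs f] with x hx
  rw [hx, norm_mul]

theorem theorem3 (Emin Emax δ : ℝ) (hEmin : 0 < Emin) (hE : Emin ≤ Emax) (hδ : 0 < δ)
    (α V : ℝ → ℝ) (hα : BoundedVariationOn α Set.univ) (hV : BoundedVariationOn V Set.univ)
    (hα_inf : 0 < ⨅ x, α x) (hV_sup : (⨆ x, V x) < Emin) :
    ∃ C : ℝ, 0 < C ∧ ∃ h₀ : ℝ, 0 < h₀ ∧ ∀ E ∈ Set.Icc Emin Emax, ∀ h ∈ Set.Ioc 0 h₀, ∀ ε : ℝ, 0 < ε →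
      ∃ R : L2R →L[ℂ] L2R,
        IsResolventAt (schrodingerOp α V E h) (Complex.I * ε) R ∧
        ‖weightOp ((1 + δ) / 2) (by positivity) ∘L R ∘L weightOp ((1 + δ) / 2) (by positivity)‖
          ≤ C * h⁻¹ := by
  have hα₀ : ∀ x, (⨅ x, α x) ≤ α x :=
    ciInf_le ⟨-(|α 0| + (eVariationOn α univ).toReal),
      forall_mem_range.2 fun x => (_root_.abs_le.1 (hα.abs_le x)).1⟩
  have hα₁ (x : ℝ) : α x ≤ |α 0| + (eVariationOn α univ).toReal :=
    (le_abs_self _).trans (hα.abs_le x)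
  have hv₁ : ∀ x, V x ≤ ⨆ x, V x :=
    le_ciSup ⟨|V 0| + (eVariationOn V univ).toReal,
      forall_mem_range.2 fun x => (_root_.abs_le.1 (hV.abs_le x)).2⟩
  obtain ⟨m, κ, K, T, hT, hcE⟩ := exists_energyCoeffs (Emax := Emax) hα hV hα_inf hα₀ hv₁ hV_sup
  have hαm := hα.measurable
  set D := Real.exp (T / κ) * (2 * K) * (2 + (K + 1) / κ) / κ
  set w := ‖(memLp_two_weight hδ).toLp _‖
  have hκ := (hcE Emin ⟨le_rfl, hE⟩).pos
  have hK : 0 < K := hκ.trans_le (((hcE Emin ⟨le_rfl, hE⟩).left_ge 0).trans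
    ((hcE Emin ⟨le_rfl, hE⟩).left_le 0))
  have hD0 : 0 < D := by positivity
  have hw0 : 0 ≤ w := norm_nonneg _
  -- The term `D * w * w` handles `ε ≤ 1`, with one factor `w` from each weight; the extra `1`
  -- handles `ε > 1`, and only there does `h ≤ 1` enter, through `1 ≤ h⁻¹`.
  refine ⟨D * w * w + 1, by positivity, 1, one_pos, fun E hE' h hh ε hε => ?_⟩
  have hc := hcE E hE'
  have hs : 0 ≤ (1 + δ) / 2 := by positivity
  obtain ⟨R, hR⟩ := exists_mem_schrodingerGraph (V := V) (E := E) (ε := ε)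
    (k := |V 0| + (eVariationOn V univ).toReal + |E|) hαm hV.measurable hα_inf hα₀ hα₁
    (fun x => (abs_sub _ _).trans (add_le_add_left (hV.abs_le x) _)) hh.1 hε
  refine ⟨R, isResolventAt_of_forall_mem_schrodingerGraph hαm hα_inf hα₀ hα₁ hc hh.1 hε hR, ?_⟩
  have hinv : 1 ≤ h⁻¹ := (one_le_inv₀ hh.1).2 hh.2
  refine ContinuousLinearMap.opNorm_le_bound _ (by have := hh.1; positivity) fun f => ?_
  change ‖weightOp ((1 + δ) / 2) hs (R (weightOp ((1 + δ) / 2) hs f))‖ ≤ _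
  set g := weightOp ((1 + δ) / 2) hs f
  rcases le_or_gt ε 1 with hε1 | hε1
  · obtain ⟨U, W, hU, hW, hsol⟩ := exists_systemSolution hαm hα_inf hα₀ hα₁ hh.1 (hR g)
    have hbd := hsol.norm_le hc hh.1 hε hε1 ((Lp.memLp _).ae_eq hU) hW (Lp.memLp g)
      (integrable_weightOp hδ hs f) hT
    refine (norm_weightOp_le_of_bound hδ hs (hU.mono fun x hx => ?_)).trans
      (?_ : D * h⁻¹ * (w * ‖f‖) * w ≤ _)
    · rw [hx]
      exact (hbd x).trans (mul_le_mul_of_nonneg_left (integral_norm_weightOp_le hδ hs f)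
        (by positivity))
    · have : 0 ≤ h⁻¹ * ‖f‖ := by positivity
      linarith
  · refine (norm_weightOp_le _ hs _).trans ?_
    have h1 := norm_le_of_mem_schrodingerGraph hαm hα_inf hα₀ hα₁ hc hh.1 (hR g)
    have h2 := norm_weightOp_le _ hs f
    have h3 : 1 * ‖R g‖ ≤ ε * ‖R g‖ := mul_le_mul_of_nonneg_right hε1.le (norm_nonneg _)
    have h4 : 1 * ‖f‖ ≤ (D * w * w + 1) * h⁻¹ * ‖f‖ := by
      refine mul_le_mul_of_nonneg_right ?_ (norm_nonneg _)
      have : 0 ≤ D * w * w * h⁻¹ := by positivity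
      linarith
    linarith
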